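/- Let $n\ge 1$. Identify the Heisenberg group $\mathbb H^n$ with $\mathbb R^{2n+1}$, with coordinates $(x_1,y_1,\dots,x_n,y_n,t)$, Lebesgue measure, and the left-invariant vector fields $$X_j=\frac{\partial}{\partial x_j}+2y_j\frac{\partial}{\partial t},\qquad Y_j=\frac{\partial}{\partial y_j}-2x_j\frac{\partial}{\partial t},\qquad 1\le j\le n.$$ For a domain (non-empty connected open set) $\Omega\subset\mathbb H^n$ let $S^1(\Omega)$ be the space of all complex-valued $u\in L_2(\Omega)$ whose distributional derivatives $X_ju$, $Y_ju$ $(1\le j\le n)$ belong to $L_2(\Omega)$, with the norm $\big(\sum_{j=1}^n(\|X_ju\|^2+\|Y_ju\|^2)+\|u\|^2\big)^{1/2}$, and let $\mathring S^1(\Omega)$ be the closure of $C_0^\infty(\Omega)$ in $S^1(\Omega)$. Let the Neumann sub-Laplacian $L^N_\Omega$ and the Dirichlet sub-Laplacian $L^D_\Omega$ be the self-adjoint operators in $L_2(\Omega)$ corresponding to the quadratic form $\sum_{j=1}^n\big(\|X_ju\|^2+\|Y_ju\|^2\big)$ with form domains $S^1(\Omega)$ and $\mathring S^1(\Omega)$,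 respectively. **Theorem.** Let $\Omega\subset\mathbb H^n$ be a domain of finite measure such that the embedding $S^1(\Omega)\subset L_2(\Omega)$ is compact. Then $L^N_\Omega$ and $L^D_\Omega$ have purely discrete spectrum and, denoting by $\lambda_1(A)\le\lambda_2(A)\le\cdots$ the eigenvalues of such an operator $A$ in nondecreasing order, counted with multiplicities, $$\lambda_{j+1}(L^N_\Omega)<\lambda_j(L^D_\Omega)\qquad\text{for every } j\in\mathbb N=\{1,2,\dots\}.$$ -/

import Mathlib

open MeasureTheory Filter Topology
open scoped ContDiff InnerProductSpace

noncomputable section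

/-- The underlying manifold `ℝ^{2n+1}` of the Heisenberg group `ℍⁿ`; a point is `p = (x, y, t)` with
`x = p.1`, `y = p.2.1`, `t = p.2.2`. The measure `volume` is Lebesgue measure, which is the Haar
measure of `ℍⁿ`. (The norm of the product space enters only through its topology.) -/
abbrev Heis (n : ℕ) : Type := (Fin n → ℝ) × (Fin n → ℝ) × ℝ

/-- The left-invariant horizontal vector fields: the index `Sum.inl j` stands for
`X_j = ∂/∂x_j + 2 y_j ∂/∂t` and `Sum.inr j` for `Y_j = ∂/∂y_j - 2 x_j ∂/∂t`. -/
def horizontalField {n : ℕ} : Fin n ⊕ Fin n → Heis n → Heis n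
  | Sum.inl j, p => (Pi.single j 1, 0, 2 * p.2.1 j)
  | Sum.inr j, p => (0, Pi.single j 1, -2 * p.1 j)

/-- The action of a horizontal vector field on a differentiable function. -/
def horizontalDeriv {n : ℕ} (i : Fin n ⊕ Fin n) (φ : Heis n → ℂ) (p : Heis n) : ℂ :=
  fderiv ℝ φ p (horizontalField i p)

/-- `φ ∈ C₀^∞(Ω)`, complex-valued. -/
structure IsTestFunction {n : ℕ} (Ω : Set (Heis n)) (φ : Heis n → ℂ) : Prop where
  smooth : ContDiff ℝ ∞ φ
  compact : HasCompactSupport φ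
  supp : tsupport φ ⊆ Ω

/-- The complex Hilbert space `L₂(Ω)`. -/
abbrev L2 {n : ℕ} (Ω : Set (Heis n)) : Type := Lp ℂ 2 (volume.restrict Ω)

/-- `g` is the distributional derivative of `u` in `Ω` along the horizontal field with index `i`.
(The fields are divergence free, so the formal adjoint of `X_j` is `-X_j`, and likewise `Y_j`.) -/
def IsWeakHorizontalDeriv {n : ℕ} (Ω : Set (Heis n)) (i : Fin n ⊕ Fin n) (u g : L2 Ω) : Prop :=
  ∀ φ : Heis n → ℂ, IsTestFunction Ω φ →
    ∫ p in Ω, g p * φ p = - ∫ p in Ω, u p * horizontalDeriv i φ p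

/-- The Hilbert space of pairs `(u, (g_i)_i)` with `u` and all `g_i` in `L₂(Ω)`, with norm
`(‖u‖² + ∑ i, ‖g_i‖²)^{1/2}`. -/
abbrev FirstOrderPair {n : ℕ} (Ω : Set (Heis n)) : Type :=
  WithLp 2 (L2 Ω × PiLp 2 (fun _ : Fin n ⊕ Fin n => L2 Ω))

theorem continuous_horizontalField {n : ℕ} (i : Fin n ⊕ Fin n) :
    Continuous (horizontalField (n := n) i) := by
  cases i <;> (unfold horizontalField; fun_prop)

theorem IsTestFunction.memLp {n : ℕ} {Ω : Set (Heis n)} {φ : Heis n → ℂ}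
    (h : IsTestFunction Ω φ) : MemLp φ 2 (volume.restrict Ω) :=
  (h.smooth.continuous.memLp_of_hasCompactSupport h.compact).restrict Ω

theorem IsTestFunction.memLp_horizontalDeriv {n : ℕ} {Ω : Set (Heis n)} {φ : Heis n → ℂ}
    (h : IsTestFunction Ω φ) (i : Fin n ⊕ Fin n) :
    MemLp (horizontalDeriv i φ) 2 (volume.restrict Ω) := by
  have hc : Continuous (horizontalDeriv i φ) :=
    (h.smooth.continuous_fderiv (by simp)).clm_apply (continuous_horizontalField i)
  have hs : HasCompactSupport (horizontalDeriv i φ) := by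
    refine (h.compact.fderiv ℝ).mono fun p hp => ?_
    contrapose! hp
    simp only [Function.mem_support, not_not] at hp ⊢
    simp [horizontalDeriv, hp]
  exact (hc.memLp_of_hasCompactSupport hs).restrict Ω

theorem L2.integrable_mul {n : ℕ} {Ω : Set (Heis n)} (u : L2 Ω) {φ : Heis n → ℂ}
    (h : MemLp φ 2 (volume.restrict Ω)) :
    Integrable (fun p => u p * φ p) (volume.restrict Ω) :=
  (Lp.memLp u).integrable_mul h

theorem L2.integral_zero_mul {n : ℕ} {Ω : Set (Heis n)} (φ : Heis n → ℂ) :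
    ∫ p in Ω, (0 : L2 Ω) p * φ p = 0 := by
  rw [← integral_zero (Heis n) ℂ (μ := volume.restrict Ω)]
  refine integral_congr_ae ?_
  filter_upwards [Lp.coeFn_zero ℂ 2 (volume.restrict Ω)] with p hp
  rw [hp, Pi.zero_apply, zero_mul]

theorem L2.integral_add_mul {n : ℕ} {Ω : Set (Heis n)} (u v : L2 Ω) {φ : Heis n → ℂ}
    (h : MemLp φ 2 (volume.restrict Ω)) :
    ∫ p in Ω, (u + v) p * φ p = (∫ p in Ω, u p * φ p) + ∫ p in Ω, v p * φ p := by
  rw [← integral_add (u.integrable_mul h) (v.integrable_mul h)]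
  refine integral_congr_ae ?_
  filter_upwards [Lp.coeFn_add u v] with p hp
  rw [hp, Pi.add_apply, add_mul]

theorem L2.integral_smul_mul {n : ℕ} {Ω : Set (Heis n)} (c : ℂ) (u : L2 Ω) (φ : Heis n → ℂ) :
    ∫ p in Ω, (c • u) p * φ p = c * ∫ p in Ω, u p * φ p := by
  rw [← integral_const_mul]
  refine integral_congr_ae ?_
  filter_upwards [Lp.coeFn_smul c u] with p hp
  rw [hp, Pi.smul_apply, smul_eq_mul, mul_assoc]

/-- The Folland–Stein space `S¹(Ω)` of all `u ∈ L₂(Ω)` whose distributional derivatives `X_j u`, `Y_j u`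
lie in `L₂(Ω)`, with the norm `(∑ j, (‖X_j u‖² + ‖Y_j u‖²) + ‖u‖²)^{1/2}`. An element is stored as `u`
together with its (uniquely determined) distributional derivatives `X_1 u, …, Y_n u`. -/
def S1 {n : ℕ} (Ω : Set (Heis n)) : Submodule ℂ (FirstOrderPair Ω) where
  carrier := {p | ∀ i, IsWeakHorizontalDeriv Ω i p.fst (p.snd i)}
  zero_mem' := by
    intro i φ _
    have h1 : ((0 : FirstOrderPair Ω).snd i) = 0 := rfl
    have h2 : (0 : FirstOrderPair Ω).fst = 0 := rfl
    rw [h1, h2, L2.integral_zero_mul, L2.integral_zero_mul, neg_zero]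
  add_mem' := by
    intro p q hp hq i φ hφ
    have h1 : (p + q).snd i = p.snd i + q.snd i := rfl
    have h2 : (p + q).fst = p.fst + q.fst := rfl
    rw [h1, h2, L2.integral_add_mul _ _ hφ.memLp,
      L2.integral_add_mul _ _ (hφ.memLp_horizontalDeriv i), hp i φ hφ, hq i φ hφ, neg_add]
  smul_mem' := by
    intro c p hp i φ hφ
    have h1 : (c • p).snd i = c • p.snd i := rfl
    have h2 : (c • p).fst = c • p.fst := rfl
    rw [h1, h2, L2.integral_smul_mul, L2.integral_smul_mul, hp i φ hφ, mul_neg]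

/-- The embedding `S¹(Ω) ⊂ L₂(Ω)`. -/
def S1.embedding {n : ℕ} (Ω : Set (Heis n)) (p : S1 Ω) : L2 Ω := (p : FirstOrderPair Ω).fst

/-- `C₀^∞(Ω)` as a subspace of `S¹(Ω)`. -/
def S1.testFunctions {n : ℕ} (Ω : Set (Heis n)) : Submodule ℂ (FirstOrderPair Ω) where
  carrier := {p | p ∈ S1 Ω ∧ ∃ φ : Heis n → ℂ, IsTestFunction Ω φ ∧ p.fst =ᵐ[volume.restrict Ω] φ}
  zero_mem' := by
    refine ⟨(S1 Ω).zero_mem, 0, ⟨contDiff_const, HasCompactSupport.zero, by simp⟩, ?_⟩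
    exact Lp.coeFn_zero ℂ 2 (volume.restrict Ω)
  add_mem' := by
    rintro p q ⟨hp, φ, hφ, hpφ⟩ ⟨hq, ψ, hψ, hqψ⟩
    refine ⟨(S1 Ω).add_mem hp hq, φ + ψ, ⟨hφ.smooth.add hψ.smooth, hφ.compact.add hψ.compact,
      (tsupport_add φ ψ).trans (Set.union_subset hφ.supp hψ.supp)⟩, ?_⟩
    exact (Lp.coeFn_add p.fst q.fst).trans (hpφ.add hqψ)
  smul_mem' := by
    rintro c p ⟨hp, φ, hφ, hpφ⟩
    refine ⟨(S1 Ω).smul_mem c hp, c • φ, ⟨contDiff_const.smul hφ.smooth, hφ.compact.smul_left,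
      (closure_mono (Function.support_const_smul_subset c φ)).trans hφ.supp⟩, ?_⟩
    exact (Lp.coeFn_smul c p.fst).trans (hpφ.const_smul c)

/-- The space `S̊¹(Ω)`, the closure of `C₀^∞(Ω)` in the (complete) space `S¹(Ω)`. -/
def S1zero {n : ℕ} (Ω : Set (Heis n)) : Submodule ℂ (FirstOrderPair Ω) :=
  (S1.testFunctions Ω).topologicalClosure

/-- The sesquilinear form `∑ j, (⟪X_j u, X_j v⟫ + ⟪Y_j u, Y_j v⟫)`, whose quadratic form is
`∑ j, (‖X_j u‖² + ‖Y_j u‖²)`; antilinear in the first argument. -/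
def horizontalForm {n : ℕ} {Ω : Set (Heis n)} (p q : FirstOrderPair Ω) : ℂ :=
  ∑ i, ⟪p.snd i, q.snd i⟫_ℂ

/-- The graph of the operator associated with the form `horizontalForm` on the form domain `Q`: the
pairs `(u, f)` with `u ∈ Q` and `a(v, u) = ⟪v, f⟫` for all `v ∈ Q`. -/
def formGraph {n : ℕ} {Ω : Set (Heis n)} (Q : Submodule ℂ (FirstOrderPair Ω)) :
    Submodule ℂ (L2 Ω × L2 Ω) where
  carrier := {w | ∃ p ∈ Q, p.fst = w.1 ∧ ∀ q ∈ Q, horizontalForm q p = ⟪q.fst, w.2⟫_ℂ}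
  zero_mem' := by
    refine ⟨0, Q.zero_mem, rfl, fun q _ => ?_⟩
    simp [horizontalForm]
  add_mem' := by
    rintro w w' ⟨p, hp, hpw, hpq⟩ ⟨p', hp', hpw', hpq'⟩
    refine ⟨p + p', Q.add_mem hp hp', by simp [hpw, hpw'], fun q hq => ?_⟩
    have h (i : Fin n ⊕ Fin n) : (p + p').snd i = p.snd i + p'.snd i := rfl
    rw [Prod.snd_add, inner_add_right, ← hpq q hq, ← hpq' q hq]
    simp only [horizontalForm, h, inner_add_right, Finset.sum_add_distrib]
  smul_mem' := by
    rintro c w ⟨p, hp, hpw, hpq⟩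
    refine ⟨c • p, Q.smul_mem c hp, by simp [hpw], fun q hq => ?_⟩
    have h (i : Fin n ⊕ Fin n) : (c • p).snd i = c • p.snd i := rfl
    rw [Prod.smul_snd, inner_smul_right, ← hpq q hq]
    simp only [horizontalForm, h, inner_smul_right, Finset.mul_sum]

/-- The (unbounded) operator in `L₂(Ω)` corresponding to the form `horizontalForm` with form domain
`Q`. For the dense form domains used below `formGraph Q` is single-valued, so it is the graph of this
operator. -/
def formOperator {n : ℕ} {Ω : Set (Heis n)} (Q : Submodule ℂ (FirstOrderPair Ω)) :
    L2 Ω →ₗ.[ℂ] L2 Ω :=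
  (formGraph Q).toLinearPMap

/-- The Neumann sub-Laplacian `L_Ω^N`. -/
def neumannSubLaplacian {n : ℕ} (Ω : Set (Heis n)) : L2 Ω →ₗ.[ℂ] L2 Ω := formOperator (S1 Ω)

/-- The Dirichlet sub-Laplacian `L_Ω^D`. -/
def dirichletSubLaplacian {n : ℕ} (Ω : Set (Heis n)) : L2 Ω →ₗ.[ℂ] L2 Ω := formOperator (S1zero Ω)

/-- The operator `A` in the infinite-dimensional Hilbert space `H` has purely discrete spectrum, and
`lam 0 ≤ lam 1 ≤ lam 2 ≤ …` are its eigenvalues in nondecreasing order, counted with multiplicities: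
there is an orthonormal basis of `H` made of eigenvectors of `A` to these eigenvalues, and
`lam k → ∞`. The `j`-th eigenvalue `λ_j(A)`, `j = 1, 2, …`, is `lam (j - 1)`. -/
def IsEigenvalueSequence {H : Type*} [NormedAddCommGroup H] [InnerProductSpace ℂ H]
    (A : H →ₗ.[ℂ] H) (lam : ℕ → ℝ) : Prop :=
  Monotone lam ∧ Tendsto lam atTop atTop ∧
    ∃ e : HilbertBasis ℕ ℂ H, ∀ k, ∃ hk : e k ∈ A.domain, A ⟨e k, hk⟩ = (lam k : ℂ) • e k

end

/-!
The comparison follows Filonov's variational argument. Let `a` be the horizontal form and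
`l = λ_j(L^D)`. Take as trial space the
sum of the span of the first `j` Dirichlet eigenfunctions, of the Neumann eigenspace
`ker (L^N - l)`, and of one unitary character `u(x, y, t) = exp(i ξ · (x, y))` of the Heisenberg
group with `|ξ|² = l`. Since `X_i u = i ξ_i u`, the character satisfies `a(u, u) = l ‖u‖²`, and
Green's formula gives `a(v, u) = l ⟪v, u⟫` for `v ∈ S̊¹(Ω)`; being bounded, it lies in `S¹(Ω)`
because `Ω` has finite measure. Hence `a(w, w) ≤ l ‖w‖²` on the whole trial space
(`norm_snd_sq_le_of_add`). If `λ_{j+1}(L^N) ≥ l`, the trial space has more dimensions than there are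
Neumann eigenvalues `≤ l`, and a trial function orthogonal to the corresponding Neumann
eigenfunctions contradicts `mul_norm_sq_lt_of_orthogonal`.

The dimension count needs three facts.

* The character can be chosen outside the span of the other trial functions: for `l > 0` there are
  infinitely many frequencies on the circle `|ξ|² = l`, and the characters are linearly independent
  on an open set (`linearIndependent_characterPair`). This also shows that `L₂(Ω)` is
  infinite-dimensional.
* `l > 0`: a function in `S̊¹(Ω)` with `X_1 u = 0` vanishes, by Green's formula applied to `u` and
  `arctan(x_1) u` (`eq_zero_of_snd_eq_zero`).
* No non-zero element of `S̊¹(Ω)` is a Neumann eigenfunction to an eigenvalue `l ≠ 0`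
  (`eq_zero_of_mem_S1zero_of_neumann`). Extended by zero it would be an `L₂` eigenfunction of the
  sub-Laplacian on the whole group. The dilation by `s` turns it into an eigenfunction to the
  eigenvalue `s² l`, so it is orthogonal to its own dilations for `s ≠ 1`; letting `s → 1` gives that
  it is zero. This replaces a unique continuation theorem.

Discreteness of the spectra is the spectral theorem for the compact operator `J J†`, where `J` is the
embedding of the form domain into `L₂(Ω)`; it is the inverse of the form operator plus one.
-/

/-! ### Horizontal derivatives of smooth functions -/

/-- A horizontal field is a constant field plus a linear multiple of the vertical field, the
multiplier being constant along the vertical direction; in particular it is divergence free. -/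
theorem horizontalField_eq_add_smul {n : ℕ} (i : Fin n ⊕ Fin n) :
    ∃ (v e : Heis n) (m : Heis n →L[ℝ] ℝ), m e = 0 ∧
      ∀ p, horizontalField i p = v + m p • e := by
  cases i with
  | inl j =>
    refine ⟨(Pi.single j 1, 0, 0), (0, 0, 1),
      (2 : ℝ) • (ContinuousLinearMap.proj j).comp ((ContinuousLinearMap.fst ℝ _ _).comp
        (ContinuousLinearMap.snd ℝ _ _)), by simp, fun p => ?_⟩
    simp [horizontalField]
  | inr j =>
    refine ⟨(0, Pi.single j 1, 0), (0, 0, 1),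
      (-2 : ℝ) • (ContinuousLinearMap.proj j).comp (ContinuousLinearMap.fst ℝ _ _),
      by simp, fun p => ?_⟩
    simp [horizontalField]

theorem horizontalDeriv_mul {n : ℕ} (i : Fin n ⊕ Fin n) {f g : Heis n → ℂ}
    (hf : ContDiff ℝ ∞ f) (hg : ContDiff ℝ ∞ g) (p : Heis n) :
    horizontalDeriv i (fun q => f q * g q) p =
      horizontalDeriv i f p * g p + f p * horizontalDeriv i g p := by
  have h := fderiv_fun_mul (hf.differentiable (by simp) p) (hg.differentiable (by simp) p)
  simp only [horizontalDeriv, h]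
  simp
  ring

theorem horizontalDeriv_conj {n : ℕ} (i : Fin n ⊕ Fin n) {f : Heis n → ℂ}
    (hf : ContDiff ℝ ∞ f) (p : Heis n) :
    horizontalDeriv i (fun q => (starRingEnd ℂ) (f q)) p =
      (starRingEnd ℂ) (horizontalDeriv i f p) := by
  have h : HasFDerivAt (fun q => Complex.conjCLE (f q)) _ p :=
    Complex.conjCLE.hasFDerivAt.comp p (hf.differentiable (by simp) p).hasFDerivAt
  have h' := h.fderiv
  simp only [Complex.conjCLE_apply] at h'
  simp [horizontalDeriv, h']

/-- Instance search does not split the product volume of `Heis n` into its factors. -/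
instance isAddHaarMeasure_volume_heis (n : ℕ) :
    (volume : Measure (Heis n)).IsAddHaarMeasure :=
  haveI : (volume : Measure ((Fin n → ℝ) × ℝ)).IsAddHaarMeasure :=
    Measure.prod.instIsAddHaarMeasure (volume : Measure (Fin n → ℝ)) (volume : Measure ℝ)
  Measure.prod.instIsAddHaarMeasure (volume : Measure (Fin n → ℝ))
    (volume : Measure ((Fin n → ℝ) × ℝ))

/-- Integration by parts along a horizontal field, without boundary terms. -/
theorem integral_horizontalDeriv_mul {n : ℕ} (i : Fin n ⊕ Fin n) {f φ : Heis n → ℂ}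
    (hf : ContDiff ℝ ∞ f) (hφ : ContDiff ℝ ∞ φ) (hc : HasCompactSupport φ) :
    ∫ p, horizontalDeriv i f p * φ p = - ∫ p, f p * horizontalDeriv i φ p := by
  obtain ⟨v, e, m, hme, hfield⟩ := horizontalField_eq_add_smul i
  have hdf : Continuous (fderiv ℝ f) := hf.continuous_fderiv (by simp)
  have parts : ∀ (w : Heis n) (ψ : Heis n → ℂ), ContDiff ℝ ∞ ψ → HasCompactSupport ψ →
      Integrable (fun p => fderiv ℝ f p w * ψ p) ∧ Integrable (fun p => f p * fderiv ℝ ψ p w) ∧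
        ∫ p, fderiv ℝ f p w * ψ p = - ∫ p, f p * fderiv ℝ ψ p w := by
    intro w ψ hψ hψc
    have hdψ : Continuous (fderiv ℝ ψ) := hψ.continuous_fderiv (by simp)
    have hcd : HasCompactSupport fun p => fderiv ℝ ψ p w := hψc.fderiv_apply ℝ w
    have h1 : Integrable (fun p => fderiv ℝ f p w * ψ p) :=
      ((hdf.clm_apply continuous_const).mul hψ.continuous).integrable_of_hasCompactSupport
        hψc.mul_left
    have h2 : Integrable (fun p => f p * fderiv ℝ ψ p w) :=
      (hf.continuous.mul (hdψ.clm_apply continuous_const)).integrable_of_hasCompactSupport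
        hcd.mul_left
    have h3 : Integrable (fun p => f p * ψ p) :=
      (hf.continuous.mul hψ.continuous).integrable_of_hasCompactSupport hψc.mul_left
    refine ⟨h1, h2, ?_⟩
    rw [integral_mul_fderiv_eq_neg_fderiv_mul_of_integrable h1 h2 h3
      (fun x _ => hf.differentiable (by simp) x) (fun x _ => hψ.differentiable (by simp) x),
      neg_neg]
  -- the vertical part is integrated by parts with the linear multiplier put on the test function
  have hmφ : ContDiff ℝ ∞ fun p => (m p : ℂ) * φ p :=
    (Complex.ofRealCLM.contDiff.comp m.contDiff).mul hφ
  obtain ⟨a1, a2, a3⟩ := parts v φ hφ hc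
  obtain ⟨b1, b2, b3⟩ := parts e (fun p => (m p : ℂ) * φ p) hmφ hc.mul_left
  have hd : ∀ p, fderiv ℝ (fun p => (m p : ℂ) * φ p) p e = (m p : ℂ) * fderiv ℝ φ p e := by
    intro p
    have hm : HasFDerivAt (fun p => (m p : ℂ)) (Complex.ofRealCLM.comp m) p :=
      (Complex.ofRealCLM.comp m).hasFDerivAt
    have h := (hm.mul (hφ.differentiable (by simp) p).hasFDerivAt).fderiv
    rw [show (fun p => (m p : ℂ) * φ p) = (fun p => (m p : ℂ)) * φ from rfl, h]
    simp [hme]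
  simp only [hd] at b2 b3
  have e1 : ∀ p, horizontalDeriv i f p * φ p =
      fderiv ℝ f p v * φ p + fderiv ℝ f p e * ((m p : ℂ) * φ p) := by
    intro p
    simp [horizontalDeriv, hfield]
    ring
  have e2 : ∀ p, f p * horizontalDeriv i φ p =
      f p * fderiv ℝ φ p v + f p * ((m p : ℂ) * fderiv ℝ φ p e) := by
    intro p
    simp [horizontalDeriv, hfield]
    ring
  simp only [e1, e2]
  rw [integral_add a1 b1, integral_add a2 b2, a3, b3, neg_add]

/-! ### Test functions -/

theorem IsTestFunction.mul_left {n : ℕ} {Ω : Set (Heis n)} {φ f : Heis n → ℂ}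
    (h : IsTestFunction Ω φ) (hf : ContDiff ℝ ∞ f) : IsTestFunction Ω fun p => f p * φ p where
  smooth := hf.mul h.smooth
  compact := h.compact.mul_left
  supp := (tsupport_mul_subset_right).trans h.supp

theorem IsTestFunction.conj {n : ℕ} {Ω : Set (Heis n)} {φ : Heis n → ℂ}
    (h : IsTestFunction Ω φ) : IsTestFunction Ω fun p => (starRingEnd ℂ) (φ p) where
  smooth := Complex.conjCLE.contDiff.comp h.smooth
  compact := h.compact.comp_left (map_zero _)
  supp := (closure_mono fun p hp => by
    contrapose! hp
    simp only [Function.mem_support, not_not] at hp ⊢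
    simp [hp]).trans h.supp

theorem IsTestFunction.apply_eq_zero {n : ℕ} {Ω : Set (Heis n)} {φ : Heis n → ℂ}
    (h : IsTestFunction Ω φ) {p : Heis n} (hp : p ∉ Ω) : φ p = 0 :=
  image_eq_zero_of_notMem_tsupport fun h' => hp (h.supp h')

theorem IsTestFunction.horizontalDeriv_eq_zero {n : ℕ} {Ω : Set (Heis n)} {φ : Heis n → ℂ}
    (h : IsTestFunction Ω φ) (i : Fin n ⊕ Fin n) {p : Heis n} (hp : p ∉ Ω) :
    horizontalDeriv i φ p = 0 := by
  have : fderiv ℝ φ p = 0 :=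
    image_eq_zero_of_notMem_tsupport fun h' => hp (h.supp (tsupport_fderiv_subset ℝ h'))
  simp [horizontalDeriv, this]

/-! ### The space `L₂(Ω)` -/

theorem L2.inner_eq_integral {n : ℕ} {Ω : Set (Heis n)} {f g : L2 Ω} {f' g' : Heis n → ℂ}
    (hf : f =ᵐ[volume.restrict Ω] f') (hg : g =ᵐ[volume.restrict Ω] g') :
    ⟪f, g⟫_ℂ = ∫ p in Ω, (starRingEnd ℂ) (f' p) * g' p := by
  rw [MeasureTheory.L2.inner_def]
  refine integral_congr_ae ?_
  filter_upwards [hf, hg] with p h1 h2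
  rw [h1, h2, RCLike.inner_apply, mul_comm]

theorem L2.inner_toLp_left {n : ℕ} {Ω : Set (Heis n)} {φ : Heis n → ℂ}
    (hφ : MemLp φ 2 (volume.restrict Ω)) (f : L2 Ω) :
    ⟪hφ.toLp φ, f⟫_ℂ = ∫ p in Ω, f p * (starRingEnd ℂ) (φ p) := by
  rw [L2.inner_eq_integral hφ.coeFn_toLp (Filter.EventuallyEq.refl _ _)]
  simp only [mul_comm]

theorem L2.continuous_integral_mul {n : ℕ} {Ω : Set (Heis n)} {φ : Heis n → ℂ}
    (hφ : MemLp φ 2 (volume.restrict Ω)) : Continuous fun f : L2 Ω => ∫ p in Ω, f p * φ p := by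
  have h := hφ.star
  have : (fun f : L2 Ω => ∫ p in Ω, f p * φ p) = fun f => ⟪h.toLp _, f⟫_ℂ := by
    funext f
    rw [L2.inner_toLp_left]
    simp
  rw [this]
  fun_prop

/-- Test functions separate the elements of `L₂(Ω)`. -/
theorem L2.eq_zero_of_forall_integral_mul {n : ℕ} {Ω : Set (Heis n)} (hΩ : IsOpen Ω) (f : L2 Ω)
    (h : ∀ φ, IsTestFunction Ω φ → ∫ p in Ω, f p * φ p = 0) : f = 0 := by
  have hloc : LocallyIntegrableOn f Ω volume := by
    rw [locallyIntegrableOn_iff hΩ.isLocallyClosed]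
    intro K hK hKc
    have : IsFiniteMeasure (volume.restrict K) := ⟨by simpa using hKc.measure_lt_top⟩
    have hm : MemLp f 2 (volume.restrict K) :=
      (Lp.memLp f).mono_measure (Measure.restrict_mono hK le_rfl)
    exact hm.integrable (by norm_num)
  have h0 := hΩ.ae_eq_zero_of_integral_contDiff_smul_eq_zero hloc (by
    intro g hg hgc hgs
    have ht : IsTestFunction Ω fun p => (g p : ℂ) :=
      ⟨Complex.ofRealCLM.contDiff.comp hg, hgc.comp_left Complex.ofReal_zero,
        (closure_mono fun p hp => by
          contrapose! hp
          simp only [Function.mem_support, not_not] at hp ⊢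
          simp [hp]).trans hgs⟩
    rw [← h _ ht, ← setIntegral_eq_integral_of_forall_compl_eq_zero (s := Ω)]
    · refine integral_congr_ae (Eventually.of_forall fun p => ?_)
      simp [mul_comm]
    · intro p hp
      have : g p = 0 := by exact_mod_cast ht.apply_eq_zero hp
      simp [this])
  have h1 : f =ᵐ[volume.restrict Ω] 0 := (ae_restrict_iff' hΩ.measurableSet).2 h0
  exact Lp.eq_zero_iff_ae_eq_zero.2 h1

/-! ### The spaces `S¹(Ω)` and `S̊¹(Ω)` -/

theorem isClosed_S1 {n : ℕ} (Ω : Set (Heis n)) : IsClosed (S1 Ω : Set (FirstOrderPair Ω)) := by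
  have : (S1 Ω : Set (FirstOrderPair Ω)) = ⋂ (i : Fin n ⊕ Fin n) (φ : Heis n → ℂ)
      (_ : IsTestFunction Ω φ), {p | ∫ q in Ω, p.snd i q * φ q =
        - ∫ q in Ω, p.fst q * horizontalDeriv i φ q} := by
    ext p
    simp [S1, IsWeakHorizontalDeriv]
  rw [this]
  refine isClosed_iInter fun i => isClosed_iInter fun φ => isClosed_iInter fun hφ => ?_
  refine isClosed_eq ((L2.continuous_integral_mul hφ.memLp).comp ?_)
    ((L2.continuous_integral_mul (hφ.memLp_horizontalDeriv i)).comp ?_).neg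
  · fun_prop
  · fun_prop

theorem testFunctions_le_S1 {n : ℕ} (Ω : Set (Heis n)) : S1.testFunctions Ω ≤ S1 Ω :=
  fun _ hp => hp.1

theorem S1zero_le_S1 {n : ℕ} (Ω : Set (Heis n)) : S1zero Ω ≤ S1 Ω :=
  Submodule.topologicalClosure_minimal _ (testFunctions_le_S1 Ω) (isClosed_S1 Ω)

/-- A closed condition that holds on `C₀^∞(Ω)` holds on `S̊¹(Ω)`. -/
theorem S1zero_induction {n : ℕ} {Ω : Set (Heis n)} {P : FirstOrderPair Ω → Prop}
    (hP : IsClosed {p | P p}) (h : ∀ p ∈ S1.testFunctions Ω, P p) {p : FirstOrderPair Ω}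
    (hp : p ∈ S1zero Ω) : P p :=
  closure_minimal (s := (S1.testFunctions Ω : Set (FirstOrderPair Ω))) h hP hp

theorem FirstOrderPair.ext {n : ℕ} {Ω : Set (Heis n)} {p q : FirstOrderPair Ω}
    (h : p.fst = q.fst) (h' : ∀ i, p.snd i = q.snd i) : p = q := by
  refine WithLp.ofLp_injective 2 (Prod.ext h ?_)
  exact PiLp.ext h'

theorem eq_zero_of_mem_S1 {n : ℕ} {Ω : Set (Heis n)} (hΩ : IsOpen Ω) {p : FirstOrderPair Ω}
    (hp : p ∈ S1 Ω) (h : p.fst = 0) : p = 0 := by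
  refine FirstOrderPair.ext h fun i => ?_
  refine L2.eq_zero_of_forall_integral_mul hΩ _ fun φ hφ => ?_
  rw [hp i φ hφ, h, L2.integral_zero_mul, neg_zero]

/-- Weak horizontal derivatives are unique. -/
theorem eq_of_mem_S1 {n : ℕ} {Ω : Set (Heis n)} (hΩ : IsOpen Ω) {p q : FirstOrderPair Ω}
    (hp : p ∈ S1 Ω) (hq : q ∈ S1 Ω) (h : p.fst = q.fst) : p = q := by
  have : p - q = 0 := eq_zero_of_mem_S1 hΩ ((S1 Ω).sub_mem hp hq) (by simp [h])
  exact sub_eq_zero.1 this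

/-- A function with its classical horizontal derivatives, as a pair. -/
noncomputable def smoothPair {n : ℕ} {Ω : Set (Heis n)} {f : Heis n → ℂ}
    (h : MemLp f 2 (volume.restrict Ω))
    (h' : ∀ i, MemLp (horizontalDeriv i f) 2 (volume.restrict Ω)) : FirstOrderPair Ω :=
  WithLp.toLp 2 (h.toLp f, WithLp.toLp 2 fun i => (h' i).toLp (horizontalDeriv i f))

theorem smoothPair_fst_ae {n : ℕ} {Ω : Set (Heis n)} {f : Heis n → ℂ}
    (h : MemLp f 2 (volume.restrict Ω))
    (h' : ∀ i, MemLp (horizontalDeriv i f) 2 (volume.restrict Ω)) :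
    (smoothPair h h').fst =ᵐ[volume.restrict Ω] f := h.coeFn_toLp

theorem smoothPair_snd_ae {n : ℕ} {Ω : Set (Heis n)} {f : Heis n → ℂ}
    (h : MemLp f 2 (volume.restrict Ω))
    (h' : ∀ i, MemLp (horizontalDeriv i f) 2 (volume.restrict Ω)) (i : Fin n ⊕ Fin n) :
    (smoothPair h h').snd i =ᵐ[volume.restrict Ω] horizontalDeriv i f := (h' i).coeFn_toLp

/-- Classical horizontal derivatives are weak ones. -/
theorem smoothPair_mem_S1 {n : ℕ} {Ω : Set (Heis n)} {f : Heis n → ℂ}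
    (h : MemLp f 2 (volume.restrict Ω))
    (h' : ∀ i, MemLp (horizontalDeriv i f) 2 (volume.restrict Ω)) (hf : ContDiff ℝ ∞ f) :
    smoothPair h h' ∈ S1 Ω := by
  intro i φ hφ
  have e1 : ∫ p in Ω, (smoothPair h h').snd i p * φ p =
      ∫ p in Ω, horizontalDeriv i f p * φ p := by
    refine integral_congr_ae ?_
    filter_upwards [smoothPair_snd_ae h h' i] with p hp
    rw [hp]
  have e2 : ∫ p in Ω, (smoothPair h h').fst p * horizontalDeriv i φ p =
      ∫ p in Ω, f p * horizontalDeriv i φ p := by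
    refine integral_congr_ae ?_
    filter_upwards [smoothPair_fst_ae h h'] with p hp
    rw [hp]
  rw [e1, e2, setIntegral_eq_integral_of_forall_compl_eq_zero,
    setIntegral_eq_integral_of_forall_compl_eq_zero,
    integral_horizontalDeriv_mul i hf hφ.smooth hφ.compact]
  · intro p hp
    simp [hφ.horizontalDeriv_eq_zero i hp]
  · intro p hp
    simp [hφ.apply_eq_zero hp]

/-- The representative of an element of `C₀^∞(Ω)` and of its weak derivatives. -/
theorem exists_isTestFunction_of_mem_testFunctions {n : ℕ} {Ω : Set (Heis n)} (hΩ : IsOpen Ω)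
    {p : FirstOrderPair Ω} (hp : p ∈ S1.testFunctions Ω) :
    ∃ φ, IsTestFunction Ω φ ∧ p.fst =ᵐ[volume.restrict Ω] φ ∧
      ∀ i, p.snd i =ᵐ[volume.restrict Ω] horizontalDeriv i φ := by
  obtain ⟨hp1, φ, hφ, hpφ⟩ := hp
  refine ⟨φ, hφ, hpφ, fun i => ?_⟩
  have h : p = smoothPair hφ.memLp hφ.memLp_horizontalDeriv :=
    eq_of_mem_S1 hΩ hp1 (smoothPair_mem_S1 _ _ hφ.smooth)
      (Lp.ext (hpφ.trans (smoothPair_fst_ae hφ.memLp hφ.memLp_horizontalDeriv).symm))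
  rw [h]
  exact smoothPair_snd_ae _ _ i

theorem smoothPair_mem_testFunctions {n : ℕ} {Ω : Set (Heis n)} {φ : Heis n → ℂ}
    (hφ : IsTestFunction Ω φ) :
    smoothPair hφ.memLp hφ.memLp_horizontalDeriv ∈ S1.testFunctions Ω :=
  ⟨smoothPair_mem_S1 _ _ hφ.smooth, φ, hφ, smoothPair_fst_ae _ _⟩

/-! ### Green's formula -/

/-- Green's formula: one factor in `S̊¹(Ω)` suffices for the boundary terms to vanish. -/
theorem inner_fst_snd_of_mem_S1zero {n : ℕ} {Ω : Set (Heis n)} (hΩ : IsOpen Ω)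
    {v p : FirstOrderPair Ω} (hv : v ∈ S1zero Ω) (hp : p ∈ S1 Ω) (i : Fin n ⊕ Fin n) :
    ⟪v.fst, p.snd i⟫_ℂ = - ⟪v.snd i, p.fst⟫_ℂ := by
  refine S1zero_induction (P := fun v => ⟪v.fst, p.snd i⟫_ℂ = - ⟪v.snd i, p.fst⟫_ℂ) ?_ ?_ hv
  · exact isClosed_eq (by fun_prop) (by fun_prop)
  · intro v hv
    obtain ⟨φ, hφ, h1, h2⟩ := exists_isTestFunction_of_mem_testFunctions hΩ hv
    have h := hp i _ hφ.conj
    rw [L2.inner_eq_integral h1 (EventuallyEq.refl _ _),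
      L2.inner_eq_integral (h2 i) (EventuallyEq.refl _ _)]
    simp only [horizontalDeriv_conj i hφ.smooth] at h
    simpa only [mul_comm] using h

/-! ### Characters of the Heisenberg group -/

/-- The additive character `(x, y, t) ↦ ξ · (x, y)` of `ℍⁿ`. -/
noncomputable def heisPhase {n : ℕ} (ξ : Fin n ⊕ Fin n → ℝ) : Heis n →L[ℝ] ℝ :=
  ∑ j, (ξ (Sum.inl j) • (ContinuousLinearMap.proj j).comp (ContinuousLinearMap.fst ℝ _ _) +
    ξ (Sum.inr j) • (ContinuousLinearMap.proj j).comp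
      ((ContinuousLinearMap.fst ℝ _ _).comp (ContinuousLinearMap.snd ℝ _ _)))

theorem heisPhase_horizontalField {n : ℕ} (ξ : Fin n ⊕ Fin n → ℝ) (i : Fin n ⊕ Fin n)
    (p : Heis n) : heisPhase ξ (horizontalField i p) = ξ i := by
  cases i <;> simp [heisPhase, horizontalField, Pi.single_apply]

/-- The unitary character `(x, y, t) ↦ exp(i ξ · (x, y))` of `ℍⁿ`. -/
noncomputable def heisCharacter {n : ℕ} (ξ : Fin n ⊕ Fin n → ℝ) (p : Heis n) : ℂ :=
  Complex.exp (heisPhase ξ p * Complex.I)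

theorem contDiff_heisCharacter {n : ℕ} (ξ : Fin n ⊕ Fin n → ℝ) :
    ContDiff ℝ ∞ (heisCharacter ξ) :=
  ((Complex.ofRealCLM.contDiff.comp (heisPhase ξ).contDiff).mul contDiff_const).cexp

theorem norm_heisCharacter {n : ℕ} (ξ : Fin n ⊕ Fin n → ℝ) (p : Heis n) :
    ‖heisCharacter ξ p‖ = 1 :=
  Complex.norm_exp_ofReal_mul_I _

theorem heisCharacter_add {n : ℕ} (ξ : Fin n ⊕ Fin n → ℝ) (p q : Heis n) :
    heisCharacter ξ (p + q) = heisCharacter ξ p * heisCharacter ξ q := by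
  simp [heisCharacter, add_mul, Complex.exp_add]

theorem horizontalDeriv_heisCharacter {n : ℕ} (ξ : Fin n ⊕ Fin n → ℝ) (i : Fin n ⊕ Fin n)
    (p : Heis n) :
    horizontalDeriv i (heisCharacter ξ) p = (ξ i * Complex.I) * heisCharacter ξ p := by
  have h1 : HasFDerivAt (fun p => (heisPhase ξ p : ℂ)) (Complex.ofRealCLM.comp (heisPhase ξ)) p :=
    (Complex.ofRealCLM.comp (heisPhase ξ)).hasFDerivAt
  have h2 := ((h1.mul_const Complex.I).cexp).fderiv
  have h3 : fderiv ℝ (heisCharacter ξ) p = _ := h2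
  rw [horizontalDeriv, h3]
  simp [heisPhase_horizontalField, heisCharacter]
  ring

theorem memLp_heisCharacter {n : ℕ} {Ω : Set (Heis n)} (hfin : volume Ω < ⊤)
    (ξ : Fin n ⊕ Fin n → ℝ) : MemLp (heisCharacter ξ) 2 (volume.restrict Ω) := by
  have : IsFiniteMeasure (volume.restrict Ω) := ⟨by simpa using hfin⟩
  exact MemLp.of_bound (contDiff_heisCharacter ξ).continuous.aestronglyMeasurable 1
    (Eventually.of_forall fun p => (norm_heisCharacter ξ p).le)

theorem memLp_horizontalDeriv_heisCharacter {n : ℕ} {Ω : Set (Heis n)} (hfin : volume Ω < ⊤)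
    (ξ : Fin n ⊕ Fin n → ℝ) (i : Fin n ⊕ Fin n) :
    MemLp (horizontalDeriv i (heisCharacter ξ)) 2 (volume.restrict Ω) := by
  have h : horizontalDeriv i (heisCharacter ξ) =
      fun p => (ξ i * Complex.I) * heisCharacter ξ p :=
    funext (horizontalDeriv_heisCharacter ξ i)
  rw [h]
  exact (memLp_heisCharacter hfin ξ).const_mul _

/-- The restriction of a unitary character to `Ω`, as an element of `S¹(Ω)`. -/
noncomputable def characterPair {n : ℕ} {Ω : Set (Heis n)} (hfin : volume Ω < ⊤)
    (ξ : Fin n ⊕ Fin n → ℝ) : FirstOrderPair Ω :=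
  smoothPair (memLp_heisCharacter hfin ξ) (memLp_horizontalDeriv_heisCharacter hfin ξ)

theorem characterPair_mem_S1 {n : ℕ} {Ω : Set (Heis n)} (hfin : volume Ω < ⊤)
    (ξ : Fin n ⊕ Fin n → ℝ) : characterPair hfin ξ ∈ S1 Ω :=
  smoothPair_mem_S1 _ _ (contDiff_heisCharacter ξ)

theorem characterPair_fst_ae {n : ℕ} {Ω : Set (Heis n)} (hfin : volume Ω < ⊤)
    (ξ : Fin n ⊕ Fin n → ℝ) :
    (characterPair hfin ξ).fst =ᵐ[volume.restrict Ω] heisCharacter ξ :=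
  smoothPair_fst_ae _ _

theorem characterPair_snd {n : ℕ} {Ω : Set (Heis n)} (hfin : volume Ω < ⊤)
    (ξ : Fin n ⊕ Fin n → ℝ) (i : Fin n ⊕ Fin n) :
    (characterPair hfin ξ).snd i = (ξ i * Complex.I) • (characterPair hfin ξ).fst := by
  refine Lp.ext ?_
  filter_upwards [smoothPair_snd_ae (memLp_heisCharacter hfin ξ)
    (memLp_horizontalDeriv_heisCharacter hfin ξ) i, characterPair_fst_ae hfin ξ,
    Lp.coeFn_smul (ξ i * Complex.I) (characterPair hfin ξ).fst] with p h1 h2 h3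
  rw [h3, Pi.smul_apply, h2, smul_eq_mul, ← horizontalDeriv_heisCharacter]
  exact h1

/-- A character is a generalized eigenfunction to the eigenvalue `|ξ|²`, tested against `S̊¹(Ω)`. -/
theorem horizontalForm_characterPair {n : ℕ} {Ω : Set (Heis n)} (hΩ : IsOpen Ω)
    (hfin : volume Ω < ⊤) (ξ : Fin n ⊕ Fin n → ℝ) {v : FirstOrderPair Ω} (hv : v ∈ S1zero Ω) :
    horizontalForm v (characterPair hfin ξ) =
      ((∑ i, ξ i ^ 2 : ℝ) : ℂ) * ⟪v.fst, (characterPair hfin ξ).fst⟫_ℂ := by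
  have h (i : Fin n ⊕ Fin n) : ⟪v.snd i, (characterPair hfin ξ).snd i⟫_ℂ =
      (ξ i : ℂ) ^ 2 * ⟪v.fst, (characterPair hfin ξ).fst⟫_ℂ := by
    have h1 := inner_fst_snd_of_mem_S1zero hΩ hv (characterPair_mem_S1 hfin ξ) i
    rw [characterPair_snd, inner_smul_right] at h1 ⊢
    linear_combination (ξ i * Complex.I) * h1 -
      (ξ i : ℂ) ^ 2 * ⟪v.fst, (characterPair hfin ξ).fst⟫_ℂ * Complex.I_sq
  simp only [horizontalForm, h, ← Finset.sum_mul]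
  push_cast
  rfl

theorem horizontalForm_characterPair_self {n : ℕ} {Ω : Set (Heis n)}
    (hfin : volume Ω < ⊤) (ξ : Fin n ⊕ Fin n → ℝ) :
    horizontalForm (characterPair hfin ξ) (characterPair hfin ξ) =
      ((∑ i, ξ i ^ 2 : ℝ) : ℂ) *
        ⟪(characterPair hfin ξ).fst, (characterPair hfin ξ).fst⟫_ℂ := by
  have h (i : Fin n ⊕ Fin n) : ⟪(characterPair hfin ξ).snd i, (characterPair hfin ξ).snd i⟫_ℂ =
      (ξ i : ℂ) ^ 2 * ⟪(characterPair hfin ξ).fst, (characterPair hfin ξ).fst⟫_ℂ := by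
    rw [characterPair_snd, inner_smul_right, inner_smul_left]
    simp only [map_mul, Complex.conj_ofReal, Complex.conj_I]
    linear_combination (-(ξ i : ℂ) ^ 2 *
      ⟪(characterPair hfin ξ).fst, (characterPair hfin ξ).fst⟫_ℂ) * Complex.I_sq
  simp only [horizontalForm, h, ← Finset.sum_mul]
  push_cast
  rfl

/-- Exponentials with distinct real frequencies that are linearly dependent near one point have
trivial coefficients. -/
theorem eq_zero_of_eventually_sum_exp_eq_zero {ι : Type*} {a : ι → ℝ} (ha : Function.Injective a)
    (s : Finset ι) (c : ι → ℂ)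
    (h : ∀ᶠ z : ℝ in 𝓝 0, ∑ m ∈ s, c m * Complex.exp ((a m * z : ℝ) * Complex.I) = 0) :
    ∀ m ∈ s, c m = 0 := by
  have hana : AnalyticOnNhd ℝ
      (fun z : ℝ => ∑ m ∈ s, c m * Complex.exp ((a m * z : ℝ) * Complex.I)) Set.univ := by
    have h1 (m : ι) (z : ℝ) : AnalyticAt ℝ (fun z : ℝ => ((a m * z : ℝ) : ℂ) * Complex.I) z :=
      (Complex.ofRealCLM.analyticAt _ |>.comp (analyticAt_const.mul analyticAt_id)).mul
        analyticAt_const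
    have h2 (m : ι) (z : ℝ) : AnalyticAt ℝ
        (fun z : ℝ => c m * Complex.exp ((a m * z : ℝ) * Complex.I)) z :=
      analyticAt_const.mul ((analyticAt_cexp.restrictScalars (𝕜 := ℝ)).fun_comp (h1 m z))
    intro z _
    exact Finset.analyticAt_fun_sum _ fun m _ => h2 m z
  have h0 := hana.eq_of_eventuallyEq (g := 0) analyticOnNhd_const h
  let χ : ι → (Multiplicative ℝ →* ℂ) := fun m =>
    { toFun := fun z => Complex.exp ((a m * z.toAdd : ℝ) * Complex.I)
      map_one' := by simp
      map_mul' := fun z w => by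
        rw [← Complex.exp_add]
        congr 1
        simp
        ring }
  have hχ : Function.Injective χ := by
    intro m m' hmm
    refine ha ?_
    have hfun (z : ℝ) : Complex.exp ((a m * z : ℝ) * Complex.I) =
        Complex.exp ((a m' * z : ℝ) * Complex.I) := DFunLike.congr_fun hmm (Multiplicative.ofAdd z)
    have hd (b : ℝ) : HasDerivAt (fun z : ℝ => Complex.exp ((b * z : ℝ) * Complex.I))
        (b * Complex.I) 0 := by
      have h1 : HasDerivAt (fun z : ℝ => ((b * z : ℝ) : ℂ) * Complex.I) (b * Complex.I) 0 := by
        have := (((hasDerivAt_id (0 : ℝ)).const_mul b).ofReal_comp).mul_const Complex.I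
        simpa using this
      simpa using h1.cexp
    have h2 := (hd (a m)).unique (by simpa only [hfun] using hd (a m'))
    exact_mod_cast mul_right_cancel₀ Complex.I_ne_zero h2
  have hli := (linearIndependent_monoidHom (Multiplicative ℝ) ℂ).comp χ hχ
  refine linearIndependent_iff'.1 hli s c (funext fun z => ?_)
  have := congrFun h0 z.toAdd
  simpa [χ] using this

/-- Characters with distinct frequencies are linearly independent on every non-empty open set. -/
theorem linearIndependent_characterPair {n : ℕ} {Ω : Set (Heis n)} (hΩ : IsOpen Ω)
    (hne : Ω.Nonempty) (hfin : volume Ω < ⊤) {ι : Type*} (ξ : ι → Fin n ⊕ Fin n → ℝ) (j : Fin n)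
    (hξ : Function.Injective fun m => ξ m (Sum.inl j)) :
    LinearIndependent ℂ fun m => (characterPair hfin (ξ m)).fst := by
  rw [linearIndependent_iff']
  intro s c hs
  obtain ⟨p₀, hp₀⟩ := hne
  have hae : (fun p => ∑ m ∈ s, c m * heisCharacter (ξ m) p) =ᵐ[volume.restrict Ω] fun _ => 0 := by
    have h1 : ∀ᵐ p ∂(volume.restrict Ω), ∀ m ∈ s, (characterPair hfin (ξ m)).fst p =
        heisCharacter (ξ m) p :=
      (Finset.eventually_all s).2 fun m _ => characterPair_fst_ae hfin (ξ m)
    have h2 : ∀ᵐ p ∂(volume.restrict Ω), ∀ m ∈ s, (c m • (characterPair hfin (ξ m)).fst :) p =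
        (c m • ⇑(characterPair hfin (ξ m)).fst) p :=
      (Finset.eventually_all s).2 fun m _ => Lp.coeFn_smul _ _
    have h3 := Lp.coeFn_finsetSum s fun m => c m • (characterPair hfin (ξ m)).fst
    rw [hs] at h3
    filter_upwards [h1, h2, h3, Lp.coeFn_zero ℂ 2 (volume.restrict Ω)] with p g1 g2 g3 g4
    rw [g4] at g3
    simp only [Pi.zero_apply, Finset.sum_apply] at g3
    rw [g3]
    refine Finset.sum_congr rfl fun m hm => ?_
    rw [g2 m hm, Pi.smul_apply, g1 m hm, smul_eq_mul]
  have hon := Measure.eqOn_open_of_ae_eq hae hΩ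
    (continuous_finsetSum _ fun m _ =>
      continuous_const.mul (contDiff_heisCharacter (ξ m)).continuous).continuousOn
    continuousOn_const
  -- restrict to the line through `p₀` in the direction of `x_j`
  let e : Heis n := (Pi.single j 1, 0, 0)
  have hphase (m : ι) : heisPhase (ξ m) e = ξ m (Sum.inl j) := by
    simp [heisPhase, e, Pi.single_apply]
  have hline : ∀ᶠ z : ℝ in 𝓝 0, p₀ + z • e ∈ Ω := by
    have hc : Continuous fun z : ℝ => p₀ + z • e := by fun_prop
    exact hc.continuousAt.eventually_mem (by simpa using hΩ.mem_nhds hp₀)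
  have hzero := eq_zero_of_eventually_sum_exp_eq_zero hξ s
    (fun m => c m * heisCharacter (ξ m) p₀) (by
      filter_upwards [hline] with z hz
      refine Eq.trans ?_ (hon hz)
      refine Finset.sum_congr rfl fun m _ => ?_
      rw [heisCharacter_add, mul_assoc]
      simp [heisCharacter, hphase, mul_comm])
  intro m hm
  refine (mul_eq_zero.1 (hzero m hm)).resolve_right fun h => ?_
  have := norm_heisCharacter (ξ m) p₀
  simp [h] at this

/-- Infinitely many frequencies with the same positive energy `l`. -/
theorem exists_frequencies {n : ℕ} (j : Fin n) {l : ℝ} (hl : 0 < l) :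
    ∃ ξ : ℕ → Fin n ⊕ Fin n → ℝ, (∀ m, ∑ i, ξ m i ^ 2 = l) ∧
      Function.Injective fun m => ξ m (Sum.inl j) := by
  have hpos (m : ℕ) : (0 : ℝ) < m + 1 := by positivity
  refine ⟨fun m => Sum.elim (Pi.single j (√l / (m + 1)))
    (Pi.single j √(l - (√l / (m + 1)) ^ 2)), fun m => ?_, ?_⟩
  · have h1 : (√l / (m + 1)) ^ 2 ≤ l := by
      rw [div_pow, Real.sq_sqrt hl.le]
      refine div_le_self hl.le ?_
      have : (0 : ℝ) ≤ m := by positivity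
      nlinarith
    rw [Fintype.sum_sum_type]
    simp only [Sum.elim_inl, Sum.elim_inr]
    rw [Finset.sum_eq_single j (by intro b _ hb; simp [hb]) (by simp),
      Finset.sum_eq_single j (by intro b _ hb; simp [hb]) (by simp)]
    simp only [Pi.single_eq_same]
    rw [Real.sq_sqrt (sub_nonneg.2 h1)]
    ring
  · intro m m' h
    simp only [Sum.elim_inl, Pi.single_eq_same] at h
    have hs := Real.sqrt_pos.2 hl
    rw [div_eq_div_iff (hpos m).ne' (hpos m').ne'] at h
    have := mul_left_cancel₀ hs.ne' h
    have h' : (m : ℝ) = m' := by linarith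
    exact_mod_cast h'

/-! ### Functions in `S̊¹(Ω)` with vanishing horizontal gradient -/

theorem eq_zero_of_snd_eq_zero {n : ℕ} {Ω : Set (Heis n)} (hΩ : IsOpen Ω) (j : Fin n)
    {p : FirstOrderPair Ω} (hp : p ∈ S1zero Ω) (h : p.snd (Sum.inl j) = 0) : p.fst = 0 := by
  -- Green's formula for `p` and `arctan x_j • p` bounds a weighted `L₂` norm of `p`
  let f : Heis n → ℂ := fun p => (Real.arctan (p.1 j) : ℂ)
  let w : Heis n → ℝ := fun p => (1 + p.1 j ^ 2)⁻¹
  have hf : ContDiff ℝ ∞ f :=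
    Complex.ofRealCLM.contDiff.comp (Real.contDiff_arctan.comp (by fun_prop))
  have hfd (q : Heis n) : horizontalDeriv (Sum.inl j) f q = (w q : ℂ) := by
    have h1 : HasFDerivAt (fun q : Heis n => q.1 j) ((ContinuousLinearMap.proj j).comp
      (ContinuousLinearMap.fst ℝ (Fin n → ℝ) ((Fin n → ℝ) × ℝ))) q :=
      ((ContinuousLinearMap.proj j).comp
        (ContinuousLinearMap.fst ℝ (Fin n → ℝ) ((Fin n → ℝ) × ℝ))).hasFDerivAt
    have h2 : HasFDerivAt f _ q := Complex.ofRealCLM.hasFDerivAt.comp q h1.arctan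
    rw [horizontalDeriv, h2.fderiv]
    simp [w, horizontalField]
  have hwc : Continuous w := by
    have : ∀ q : Heis n, 1 + q.1 j ^ 2 ≠ 0 := fun q => by positivity
    exact Continuous.inv₀ (by fun_prop) this
  have hmf : MemLp (fun q => f q * p.fst q) 2 (volume.restrict Ω) := by
    refine (Lp.memLp p.fst).of_le_mul (c := Real.pi / 2)
      (hf.continuous.aestronglyMeasurable.mul (Lp.aestronglyMeasurable _))
      (Eventually.of_forall fun q => ?_)
    rw [norm_mul]
    gcongr
    rw [Complex.norm_real, Real.norm_eq_abs, abs_le]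
    exact ⟨(Real.neg_pi_div_two_lt_arctan _).le, (Real.arctan_lt_pi_div_two _).le⟩
  have hmw : MemLp (fun q => (w q : ℂ) * p.fst q) 2 (volume.restrict Ω) := by
    refine (Lp.memLp p.fst).of_le_mul (c := 1)
      ((Complex.continuous_ofReal.comp hwc).aestronglyMeasurable.mul (Lp.aestronglyMeasurable _))
      (Eventually.of_forall fun q => ?_)
    rw [norm_mul]
    gcongr
    rw [Complex.norm_real, Real.norm_eq_abs, abs_of_nonneg (by positivity)]
    exact inv_le_one_of_one_le₀ (by nlinarith [sq_nonneg (q.1 j)])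
  have key : ⟪p.fst, hmw.toLp _⟫_ℂ = - ⟪p.snd (Sum.inl j), hmf.toLp _⟫_ℂ := by
    refine S1zero_induction (P := fun v => ⟪v.fst, hmw.toLp _⟫_ℂ =
      - ⟪v.snd (Sum.inl j), hmf.toLp _⟫_ℂ) (isClosed_eq (by fun_prop) (by fun_prop)) ?_ hp
    intro v hv
    obtain ⟨φ, hφ, h1, h2⟩ := exists_isTestFunction_of_mem_testFunctions hΩ hv
    have hweak := S1zero_le_S1 Ω hp (Sum.inl j) _ (hφ.conj.mul_left hf)
    rw [h, L2.integral_zero_mul] at hweak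
    simp only [horizontalDeriv_mul _ hf hφ.conj.smooth, hfd, horizontalDeriv_conj _ hφ.smooth]
      at hweak
    rw [L2.inner_eq_integral h1 hmw.coeFn_toLp, L2.inner_eq_integral (h2 _) hmf.coeFn_toLp,
      eq_neg_iff_add_eq_zero, ← integral_add, ← neg_eq_zero, hweak]
    · congr 1
      refine integral_congr_ae (Eventually.of_forall fun q => ?_)
      simp only
      ring
    · exact hφ.memLp.star.integrable_mul hmw
    · exact (hφ.memLp_horizontalDeriv (Sum.inl j)).star.integrable_mul hmf
  rw [h, inner_zero_left, neg_zero,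
    L2.inner_eq_integral (EventuallyEq.refl _ _) hmw.coeFn_toLp] at key
  have hre : ∫ q in Ω, w q * ‖p.fst q‖ ^ 2 = 0 := by
    have : ∫ q in Ω, ((w q * ‖p.fst q‖ ^ 2 : ℝ) : ℂ) = 0 := by
      rw [← key]
      refine integral_congr_ae (Eventually.of_forall fun q => ?_)
      simp only
      push_cast
      rw [← Complex.conj_mul']
      ring
    rw [integral_complex_ofReal] at this
    exact_mod_cast this
  have hint : Integrable (fun q => w q * ‖p.fst q‖ ^ 2) (volume.restrict Ω) := by
    have h1 := ((Lp.memLp p.fst).norm).integrable_mul hmw.norm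
    refine h1.congr (Eventually.of_forall fun q => ?_)
    have : 0 ≤ w q := by positivity
    simp only [Pi.mul_apply, norm_mul, Complex.norm_real, Real.norm_eq_abs, abs_of_nonneg this]
    ring
  have h0 := (integral_eq_zero_iff_of_nonneg (fun q => by positivity) hint).1 hre
  refine Lp.eq_zero_iff_ae_eq_zero.2 ?_
  filter_upwards [h0] with q hq
  have hw : w q ≠ 0 := by positivity
  simpa [hw] using hq

/-! ### Dilations of the Heisenberg group -/

/-- The dilation `(x, y, t) ↦ (s x, s y, s² t)`. -/
noncomputable def heisDilation (n : ℕ) (s : ℝ) : Heis n →L[ℝ] Heis n :=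
  (s • ContinuousLinearMap.id ℝ _).prodMap
    ((s • ContinuousLinearMap.id ℝ _).prodMap (s ^ 2 • ContinuousLinearMap.id ℝ _))

theorem heisDilation_apply {n : ℕ} (s : ℝ) (p : Heis n) :
    heisDilation n s p = (s • p.1, s • p.2.1, s ^ 2 * p.2.2) := rfl

theorem continuous_heisDilation_left {n : ℕ} (p : Heis n) :
    Continuous fun s => heisDilation n s p := by
  simp only [heisDilation_apply]
  fun_prop

theorem heisDilation_inv_apply {n : ℕ} {s : ℝ} (hs : 0 < s) (p : Heis n) :
    heisDilation n s⁻¹ (heisDilation n s p) = p := by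
  have h := hs.ne'
  simp only [heisDilation_apply, smul_smul, inv_mul_cancel₀ h, one_smul]
  refine Prod.ext rfl (Prod.ext rfl ?_)
  field_simp

theorem heisDilation_horizontalField {n : ℕ} (s : ℝ) (i : Fin n ⊕ Fin n) (p : Heis n) :
    heisDilation n s (horizontalField i p) = s • horizontalField i (heisDilation n s p) := by
  cases i <;>
  · simp only [heisDilation_apply, horizontalField, Prod.smul_mk, smul_zero, Pi.smul_apply,
      smul_eq_mul]
    refine Prod.ext rfl (Prod.ext rfl ?_)
    ring

theorem horizontalDeriv_comp_heisDilation {n : ℕ} (s : ℝ) (i : Fin n ⊕ Fin n) {f : Heis n → ℂ}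
    (hf : ContDiff ℝ ∞ f) (p : Heis n) :
    horizontalDeriv i (fun q => f (heisDilation n s q)) p =
      s * horizontalDeriv i f (heisDilation n s p) := by
  have h : HasFDerivAt (fun q => f (heisDilation n s q)) _ p :=
    ((hf.differentiable (by simp) _).hasFDerivAt).comp p (heisDilation n s).hasFDerivAt
  rw [horizontalDeriv, h.fderiv]
  simp [heisDilation_horizontalField, horizontalDeriv]

theorem map_heisDilation {n : ℕ} {s : ℝ} (hs : 0 < s) :
    (volume : Measure (Heis n)).map (heisDilation n s) =
      ENNReal.ofReal (s ^ (2 * n + 2))⁻¹ • volume := by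
  have hdet : LinearMap.det (heisDilation n s : Heis n →ₗ[ℝ] Heis n) = s ^ (2 * n + 2) := by
    have : (heisDilation n s : Heis n →ₗ[ℝ] Heis n) = LinearMap.prodMap (s • LinearMap.id)
        (LinearMap.prodMap (s • LinearMap.id) (s ^ 2 • LinearMap.id)) := rfl
    rw [this, LinearMap.det_prodMap, LinearMap.det_prodMap, LinearMap.det_smul,
      LinearMap.det_smul]
    simp
    ring
  have h := Measure.map_linearMap_addHaar_eq_smul_addHaar (volume : Measure (Heis n))
    (f := (heisDilation n s : Heis n →ₗ[ℝ] Heis n)) (by rw [hdet]; positivity)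
  rw [hdet, abs_of_pos (by positivity)] at h
  exact h

theorem measurableEmbedding_heisDilation {n : ℕ} {s : ℝ} (hs : 0 < s) :
    MeasurableEmbedding (heisDilation n s) :=
  (heisDilation n s).continuous.measurableEmbedding
    (Function.LeftInverse.injective (heisDilation_inv_apply hs))

theorem integral_comp_heisDilation {n : ℕ} {s : ℝ} (hs : 0 < s) (F : Heis n → ℂ) :
    ∫ p, F (heisDilation n s p) = ((s ^ (2 * n + 2))⁻¹ : ℝ) * ∫ p, F p := by
  rw [← (measurableEmbedding_heisDilation hs).integral_map, map_heisDilation hs,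
    integral_smul_measure, ENNReal.toReal_ofReal (by positivity), Complex.real_smul]

theorem quasiMeasurePreserving_heisDilation {n : ℕ} {s : ℝ} (hs : 0 < s) :
    Measure.QuasiMeasurePreserving (heisDilation n s) volume volume := by
  refine ⟨(heisDilation n s).continuous.measurable, ?_⟩
  rw [map_heisDilation hs]
  exact Measure.smul_absolutelyContinuous

theorem memLp_comp_heisDilation {n : ℕ} {s : ℝ} (hs : 0 < s) {f : Heis n → ℂ}
    (hf : MemLp f 2 volume) : MemLp (fun p => f (heisDilation n s p)) 2 volume := by
  have h : MemLp f 2 ((volume : Measure (Heis n)).map (heisDilation n s)) := by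
    rw [map_heisDilation hs]
    exact hf.smul_measure ENNReal.ofReal_ne_top
  exact ((measurableEmbedding_heisDilation hs).memLp_map_measure_iff).1 h

theorem memLp_dilate {n : ℕ} {Ω : Set (Heis n)} (hΩ : IsOpen Ω) {s : ℝ} (hs : 0 < s)
    (f : L2 Ω) : MemLp (fun p => Ω.indicator f (heisDilation n s p)) 2 (volume.restrict Ω) :=
  (memLp_comp_heisDilation hs
    ((memLp_indicator_iff_restrict hΩ.measurableSet).2 (Lp.memLp f))).restrict Ω

/-- The dilation of (the extension by zero of) a function in `L₂(Ω)`, restricted to `Ω` again. -/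
noncomputable def dilate {n : ℕ} {Ω : Set (Heis n)} (hΩ : IsOpen Ω) {s : ℝ} (hs : 0 < s)
    (f : L2 Ω) : L2 Ω := (memLp_dilate hΩ hs f).toLp _

theorem dilate_ae {n : ℕ} {Ω : Set (Heis n)} (hΩ : IsOpen Ω) {s : ℝ} (hs : 0 < s) (f : L2 Ω) :
    dilate hΩ hs f =ᵐ[volume.restrict Ω] fun p => Ω.indicator f (heisDilation n s p) :=
  (memLp_dilate hΩ hs f).coeFn_toLp

theorem dilate_ae_of_ae {n : ℕ} {Ω : Set (Heis n)} (hΩ : IsOpen Ω) {s : ℝ} (hs : 0 < s)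
    {f : L2 Ω} {φ : Heis n → ℂ} (hf : f =ᵐ[volume.restrict Ω] φ) (hφ : ∀ p ∉ Ω, φ p = 0) :
    dilate hΩ hs f =ᵐ[volume.restrict Ω] fun p => φ (heisDilation n s p) := by
  have h1 : Ω.indicator f =ᵐ[volume] φ := by
    rw [Filter.EventuallyEq, ae_restrict_iff' hΩ.measurableSet] at hf
    filter_upwards [hf] with p hp
    by_cases h : p ∈ Ω
    · rw [Set.indicator_of_mem h, hp h]
    · rw [Set.indicator_of_notMem h, hφ p h]
  have h2 := (quasiMeasurePreserving_heisDilation hs).ae h1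
  exact (dilate_ae hΩ hs f).trans (ae_restrict_of_ae h2)

/-- Up to the Jacobian, the adjoint of a dilation is the inverse dilation. -/
theorem inner_dilate {n : ℕ} {Ω : Set (Heis n)} (hΩ : IsOpen Ω) {s : ℝ} (hs : 0 < s)
    (f g : L2 Ω) : ⟪f, dilate hΩ hs g⟫_ℂ =
      ((s ^ (2 * n + 2))⁻¹ : ℝ) * ⟪dilate hΩ (inv_pos.2 hs) f, g⟫_ℂ := by
  let F : Heis n → ℂ := fun q =>
    (starRingEnd ℂ) (Ω.indicator f (heisDilation n s⁻¹ q)) * Ω.indicator g q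
  have h1 : ⟪f, dilate hΩ hs g⟫_ℂ = ∫ p, F (heisDilation n s p) := by
    rw [L2.inner_eq_integral (EventuallyEq.refl _ _) (dilate_ae hΩ hs g)]
    refine Eq.trans ?_ (setIntegral_eq_integral_of_forall_compl_eq_zero (s := Ω) fun p hp => ?_)
    · refine setIntegral_congr_fun hΩ.measurableSet fun p hp => ?_
      simp only [F]
      rw [heisDilation_inv_apply hs, Set.indicator_of_mem hp]
    · simp only [F]
      rw [heisDilation_inv_apply hs, Set.indicator_of_notMem hp, map_zero, zero_mul]
  have h2 : ⟪dilate hΩ (inv_pos.2 hs) f, g⟫_ℂ = ∫ p, F p := by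
    rw [L2.inner_eq_integral (dilate_ae hΩ _ f) (EventuallyEq.refl _ _)]
    refine Eq.trans ?_ (setIntegral_eq_integral_of_forall_compl_eq_zero (s := Ω) fun p hp => ?_)
    · refine setIntegral_congr_fun hΩ.measurableSet fun p hp => ?_
      simp only [F]
      rw [Set.indicator_of_mem hp]
    · simp only [F]
      rw [Set.indicator_of_notMem hp, mul_zero]
  rw [h1, h2, integral_comp_heisDilation hs]

theorem eLpNorm_comp_heisDilation_le {n : ℕ} {s : ℝ} (hs : 1 ≤ s) (f : Heis n → ℂ) :
    eLpNorm (fun p => f (heisDilation n s p)) 2 volume ≤ eLpNorm f 2 volume := by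
  have hs0 : 0 < s := zero_lt_one.trans_le hs
  have h := (measurableEmbedding_heisDilation (n := n) hs0).eLpNorm_map_measure (g := f) (p := 2)
    (μ := volume)
  rw [Function.comp_def] at h
  rw [← h, map_heisDilation hs0]
  refine eLpNorm_mono_measure _ (Measure.le_iff.2 fun t _ => ?_)
  rw [Measure.smul_apply, smul_eq_mul]
  refine mul_le_of_le_one_left zero_le ?_
  rw [ENNReal.ofReal_le_one]
  exact inv_le_one_of_one_le₀ (one_le_pow₀ hs)

theorem norm_dilate_le {n : ℕ} {Ω : Set (Heis n)} (hΩ : IsOpen Ω) {s : ℝ}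
    (hs0 : 0 < s) (hs : 1 ≤ s) (f : L2 Ω) : ‖dilate hΩ hs0 f‖ ≤ ‖f‖ := by
  have hnorm : ‖dilate hΩ hs0 f‖ = (eLpNorm (fun p => Ω.indicator f (heisDilation n s p)) 2
      (volume.restrict Ω)).toReal := Lp.norm_toLp _ _
  suffices hle : eLpNorm (fun p => Ω.indicator f (heisDilation n s p)) 2 (volume.restrict Ω) ≤
      eLpNorm f 2 (volume.restrict Ω) by
    rw [hnorm]
    exact ENNReal.toReal_mono (Lp.eLpNorm_ne_top f) hle
  calc eLpNorm (fun p => Ω.indicator f (heisDilation n s p)) 2 (volume.restrict Ω)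
      ≤ eLpNorm (fun p => Ω.indicator f (heisDilation n s p)) 2 volume :=
        eLpNorm_mono_measure _ Measure.restrict_le_self
    _ ≤ eLpNorm (Ω.indicator f) 2 volume := eLpNorm_comp_heisDilation_le hs _
    _ = eLpNorm f 2 (volume.restrict Ω) :=
        eLpNorm_indicator_eq_eLpNorm_restrict hΩ.measurableSet

/-- Dilating a test function of `Ω` yields an element of `S¹(Ω)` (in general outside `S̊¹(Ω)`), whose
gradient scales by the dilation factor. -/
theorem exists_mem_S1_dilate {n : ℕ} {Ω : Set (Heis n)} (hΩ : IsOpen Ω) {s : ℝ} (hs : 0 < s)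
    {v : FirstOrderPair Ω} (hv : v ∈ S1.testFunctions Ω) :
    ∃ q ∈ S1 Ω, q.fst = dilate hΩ hs v.fst ∧
      ∀ i, q.snd i = (s : ℂ) • dilate hΩ hs (v.snd i) := by
  obtain ⟨φ, hφ, h1, h2⟩ := exists_isTestFunction_of_mem_testFunctions hΩ hv
  have hd (i : Fin n ⊕ Fin n) : horizontalDeriv i (fun q => φ (heisDilation n s q)) =
      fun p => s * horizontalDeriv i φ (heisDilation n s p) :=
    funext (horizontalDeriv_comp_heisDilation s i hφ.smooth)
  have hm : MemLp (fun q => φ (heisDilation n s q)) 2 (volume.restrict Ω) :=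
    (memLp_comp_heisDilation hs
      (hφ.smooth.continuous.memLp_of_hasCompactSupport hφ.compact)).restrict Ω
  have hmφ (i : Fin n ⊕ Fin n) : MemLp (horizontalDeriv i φ) 2 volume := by
    have := IsTestFunction.memLp_horizontalDeriv (Ω := Set.univ)
      ⟨hφ.smooth, hφ.compact, Set.subset_univ _⟩ i
    rwa [Measure.restrict_univ] at this
  have hm' (i : Fin n ⊕ Fin n) :
      MemLp (horizontalDeriv i (fun q => φ (heisDilation n s q))) 2 (volume.restrict Ω) := by
    rw [hd]
    exact ((memLp_comp_heisDilation hs (hmφ i)).const_mul _).restrict Ω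
  refine ⟨smoothPair hm hm', smoothPair_mem_S1 _ _ (hφ.smooth.comp (heisDilation n s).contDiff),
    Lp.ext ?_, fun i => Lp.ext ?_⟩
  · exact (smoothPair_fst_ae hm hm').trans
      (dilate_ae_of_ae hΩ hs h1 fun p hp => hφ.apply_eq_zero hp).symm
  · filter_upwards [smoothPair_snd_ae hm hm' i, Lp.coeFn_smul (s : ℂ) (dilate hΩ hs (v.snd i)),
      dilate_ae_of_ae hΩ hs (h2 i) fun p hp => hφ.horizontalDeriv_eq_zero i hp] with p g1 g2 g3
    rw [g1, g2, Pi.smul_apply, g3, hd, smul_eq_mul]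

/-! ### Absence of functions that are Dirichlet and Neumann eigenfunctions at once -/

/-- Dilations turn an eigenfunction on the whole group into one with another eigenvalue, so they
move it to an orthogonal function. -/
theorem inner_dilate_eq_zero {n : ℕ} {Ω : Set (Heis n)} (hΩ : IsOpen Ω) {l : ℝ} (hl : l ≠ 0)
    {p : FirstOrderPair Ω} (hp : p ∈ S1zero Ω)
    (h : ∀ q ∈ S1 Ω, horizontalForm q p = (l : ℂ) * ⟪q.fst, p.fst⟫_ℂ) {s : ℝ} (hs : 1 < s) :
    ⟪p.fst, dilate hΩ (zero_lt_one.trans hs) p.fst⟫_ℂ = 0 := by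
  -- the eigenvalue equation, tested with dilations of `S̊¹(Ω)`
  have main (r : ℝ) (hr : 0 < r) : ∑ i, ⟪p.snd i, dilate hΩ hr (p.snd i)⟫_ℂ =
      r * (l * ⟪p.fst, dilate hΩ hr p.fst⟫_ℂ) := by
    refine S1zero_induction (P := fun v => ∑ i, ⟪v.snd i, dilate hΩ hr (p.snd i)⟫_ℂ =
      r * (l * ⟪v.fst, dilate hΩ hr p.fst⟫_ℂ)) (isClosed_eq (by fun_prop) (by fun_prop)) ?_ hp
    intro v hv
    obtain ⟨q, hq, hq1, hq2⟩ := exists_mem_S1_dilate hΩ (inv_pos.2 hr) hv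
    have hq' := h q hq
    simp only [horizontalForm, hq1, hq2, inner_smul_left, ← Finset.mul_sum] at hq'
    simp only [inner_dilate hΩ hr, ← Finset.mul_sum]
    have hr' : (r : ℂ) ≠ 0 := by exact_mod_cast hr.ne'
    rw [Complex.conj_ofReal, Complex.ofReal_inv] at hq'
    rw [inv_mul_eq_iff_eq_mul₀ hr'] at hq'
    rw [hq']
    ring
  have hs0 := zero_lt_one.trans hs
  have h1 := main s hs0
  have h2 := main s⁻¹ (inv_pos.2 hs0)
  -- compare with the conjugate of the equation for the inverse dilation
  have h3 : ∑ i, ⟪p.snd i, dilate hΩ hs0 (p.snd i)⟫_ℂ =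
      (s⁻¹ : ℝ) * (l * ⟪p.fst, dilate hΩ hs0 p.fst⟫_ℂ) := by
    have h2' := congrArg (starRingEnd ℂ) h2
    simp only [map_sum, map_mul, inner_conj_symm, Complex.conj_ofReal] at h2'
    simp only [inner_dilate hΩ hs0, ← Finset.mul_sum, h2']
    ring
  rw [h1] at h3
  have h4 : ((s - s⁻¹ : ℝ) : ℂ) * (l * ⟪p.fst, dilate hΩ hs0 p.fst⟫_ℂ) = 0 := by
    push_cast at h3 ⊢
    linear_combination h3
  have h5 : ((s - s⁻¹ : ℝ) : ℂ) ≠ 0 := by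
    have : s⁻¹ < 1 := inv_lt_one_of_one_lt₀ hs
    have : s - s⁻¹ ≠ 0 := by linarith
    exact_mod_cast this
  have h6 : (l : ℂ) ≠ 0 := by exact_mod_cast hl
  exact ((mul_eq_zero.1 h4).resolve_left h5 |> mul_eq_zero.1).resolve_left h6

theorem tendsto_inner_dilate {n : ℕ} {Ω : Set (Heis n)} (hΩ : IsOpen Ω) (hfin : volume Ω < ⊤)
    {v : FirstOrderPair Ω} (hv : v ∈ S1.testFunctions Ω) (u : L2 Ω) {s : ℕ → ℝ}
    (hs : ∀ k, 0 < s k) (hlim : Tendsto s atTop (𝓝 1)) :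
    Tendsto (fun k => ⟪dilate hΩ (hs k) v.fst, u⟫_ℂ) atTop (𝓝 ⟪v.fst, u⟫_ℂ) := by
  obtain ⟨φ, hφ, h1, -⟩ := exists_isTestFunction_of_mem_testFunctions hΩ hv
  have : IsFiniteMeasure (volume.restrict Ω) := ⟨by simpa using hfin⟩
  obtain ⟨M, hM⟩ := hφ.compact.exists_bound_of_continuous hφ.smooth.continuous
  rw [L2.inner_eq_integral h1 (EventuallyEq.refl _ _)]
  have heq (k : ℕ) : ⟪dilate hΩ (hs k) v.fst, u⟫_ℂ =
      ∫ p in Ω, (starRingEnd ℂ) (φ (heisDilation n (s k) p)) * u p :=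
    L2.inner_eq_integral (dilate_ae_of_ae hΩ (hs k) h1 fun p hp => hφ.apply_eq_zero hp)
      (EventuallyEq.refl _ _)
  simp only [heq]
  refine tendsto_integral_of_dominated_convergence (fun p => M * ‖u p‖) (fun k => ?_) ?_
    (fun k => Eventually.of_forall fun p => ?_) (Eventually.of_forall fun p => ?_)
  · exact (Complex.continuous_conj.comp (hφ.smooth.continuous.comp
      (heisDilation n (s k)).continuous)).aestronglyMeasurable.mul (Lp.aestronglyMeasurable u)
  · exact ((Lp.memLp u).integrable (by norm_num)).norm.const_mul M
  · rw [norm_mul, RCLike.norm_conj]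
    gcongr
    exact hM _
  · have h0 : Continuous fun r => (starRingEnd ℂ) (φ (heisDilation n r p)) * u p :=
      (Complex.continuous_conj.comp (hφ.smooth.continuous.comp
        (continuous_heisDilation_left p))).mul continuous_const
    have h2 := (h0.tendsto 1).comp hlim
    have h3 : heisDilation n 1 p = p := by simp [heisDilation_apply]
    rwa [h3] at h2

/-- An element of `S̊¹(Ω)` satisfying the Neumann eigenvalue equation vanishes: extended by zero, it
would be an eigenfunction of the sub-Laplacian on the whole group. -/
theorem eq_zero_of_mem_S1zero_of_neumann {n : ℕ} {Ω : Set (Heis n)} (hΩ : IsOpen Ω)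
    (hfin : volume Ω < ⊤) {l : ℝ} (hl : l ≠ 0) {p : FirstOrderPair Ω} (hp : p ∈ S1zero Ω)
    (h : ∀ q ∈ S1 Ω, horizontalForm q p = (l : ℂ) * ⟪q.fst, p.fst⟫_ℂ) : p.fst = 0 := by
  let s : ℕ → ℝ := fun k => 1 + 1 / ((k : ℝ) + 1)
  have hs (k : ℕ) : 1 < s k := by
    have : (0 : ℝ) < 1 / ((k : ℝ) + 1) := by positivity
    simp only [s]
    linarith
  have hs0 (k : ℕ) : 0 < s k := zero_lt_one.trans (hs k)
  have hlim : Tendsto s atTop (𝓝 1) := by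
    simpa [s] using (tendsto_one_div_add_atTop_nhds_zero_nat (𝕜 := ℝ)).const_add 1
  have hlim' : Tendsto (fun k => (s k)⁻¹) atTop (𝓝 1) := by simpa using hlim.inv₀ one_ne_zero
  have bound : ‖⟪p.fst, p.fst⟫_ℂ‖ ≤ ‖p.fst - p.fst‖ * ‖p.fst‖ := by
    refine S1zero_induction (P := fun v => ‖⟪v.fst, p.fst⟫_ℂ‖ ≤ ‖v.fst - p.fst‖ * ‖p.fst‖)
      (isClosed_le (by fun_prop) (by fun_prop)) (fun v hv => ?_) hp
    have h1 : Tendsto (fun k => ‖⟪v.fst, dilate hΩ (hs0 k) p.fst⟫_ℂ‖) atTop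
        (𝓝 ‖⟪v.fst, p.fst⟫_ℂ‖) := by
      simp only [inner_dilate hΩ (hs0 _)]
      have hj : Tendsto (fun k => (((s k ^ (2 * n + 2))⁻¹ : ℝ) : ℂ)) atTop (𝓝 1) := by
        have := (hlim.pow (2 * n + 2)).inv₀ (by simp)
        simpa [Function.comp_def] using (Complex.continuous_ofReal.tendsto _).comp this
      simpa using (hj.mul (tendsto_inner_dilate hΩ hfin hv p.fst
        (fun k => inv_pos.2 (hs0 k)) hlim')).norm
    refine le_of_tendsto' h1 fun k => ?_
    have h2 : ⟪v.fst, dilate hΩ (hs0 k) p.fst⟫_ℂ =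
        ⟪v.fst - p.fst, dilate hΩ (hs0 k) p.fst⟫_ℂ := by
      rw [inner_sub_left, inner_dilate_eq_zero hΩ hl hp h (hs k), sub_zero]
    rw [h2]
    refine (norm_inner_le_norm _ _).trans ?_
    gcongr
    exact norm_dilate_le hΩ (hs0 k) (hs k).le p.fst
  rw [sub_self, norm_zero, zero_mul, norm_le_zero_iff] at bound
  exact inner_self_eq_zero.1 bound

/-! ### Spectral theorem for compact positive operators -/

/-- An infinite family of reals with finite sublevel sets can be enumerated monotonically. -/
theorem exists_equiv_nat_monotone {ι : Type*} [Infinite ι] (f : ι → ℝ)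
    (hf : ∀ C, {i | f i ≤ C}.Finite) : ∃ e : ℕ ≃ ι, Monotone (f ∘ e) := by
  have hcount : Countable ι := by
    rw [← Set.countable_univ_iff]
    have : (Set.univ : Set ι) = ⋃ m : ℕ, {i | f i ≤ m} := by
      ext i
      simpa using exists_nat_ge (f i)
    rw [this]
    exact Set.countable_iUnion fun m => (hf m).countable
  obtain ⟨enc, henc⟩ := exists_injective_nat ι
  let key : ι → ℝ ×ₗ ℕ := fun i => toLex (f i, enc i)
  have hkey : Function.Injective key := fun i j h => henc (congrArg (fun z => (ofLex z).2) h)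
  let _ : LinearOrder ι := LinearOrder.lift' key hkey
  have hmono : Monotone f := fun i j h => Prod.Lex.monotone_fst _ _ (show key i ≤ key j from h)
  have hIic (i : ι) : (Set.Iic i).Finite := (hf (f i)).subset fun j hj => hmono hj
  let _ : LocallyFiniteOrder ι := LocallyFiniteOrder.ofFiniteIcc fun i j =>
    (hIic j).subset Set.Icc_subset_Iic_self
  obtain ⟨i₀, hi₀⟩ : ∃ i₀ : ι, ∀ i, i₀ ≤ i := by
    obtain ⟨i⟩ := (inferInstance : Nonempty ι)
    obtain ⟨m, hm, hm'⟩ := (hIic i).exists_minimal ⟨i, Set.mem_Iic.2 le_rfl⟩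
    refine ⟨m, fun k => ?_⟩
    by_contra! hk
    exact (hm' (hk.le.trans hm) hk.le).not_gt hk
  let _ : OrderBot ι := { bot := i₀, bot_le := hi₀ }
  have : NoMaxOrder ι := ⟨fun i => by
    by_contra! h
    exact Set.infinite_univ ((hIic i).subset fun j _ => h j)⟩
  let _ : SuccOrder ι := LinearLocallyFiniteOrder.succOrder ι
  let _ : PredOrder ι := LinearLocallyFiniteOrder.predOrder ι
  refine ⟨(orderIsoNatOfLinearSuccPredArch (ι := ι)).symm.toEquiv, ?_⟩
  exact hmono.comp (orderIsoNatOfLinearSuccPredArch (ι := ι)).symm.monotone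

section CompactOperator

variable {H : Type*} [NormedAddCommGroup H] [InnerProductSpace ℂ H]

/-- A compact operator has only finitely many orthonormal eigenvectors with eigenvalues bounded away
from zero. -/
theorem IsCompactOperator.finite_setOf_le_eigenvalue {T : H →L[ℂ] H} (hT : IsCompactOperator T)
    {ι : Type*} {v : ι → H} (hv : Orthonormal ℂ v) {μ : ι → ℂ} (hμ : ∀ i, T (v i) = μ i • v i)
    {ε : ℝ} (hε : 0 < ε) : {i | ε ≤ ‖μ i‖}.Finite := by
  by_contra hinf
  let g := Set.Infinite.natEmbedding _ hinf
  obtain ⟨K, hK, hKsub⟩ := hT.image_closedBall_subset_compact (f := (T : H →ₗ[ℂ] H)) 1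
  have hmem (k : ℕ) : T (v (g k)) ∈ K :=
    hKsub ⟨v (g k), by simp [hv.1 (g k).1], rfl⟩
  obtain ⟨a, -, φ, hφ, hlim⟩ := hK.tendsto_subseq hmem
  obtain ⟨N, hN⟩ := Metric.cauchySeq_iff.1 hlim.cauchySeq ε hε
  have h1 := hN N le_rfl (N + 1) (Nat.le_succ N)
  have hne : (g (φ N) : ι) ≠ g (φ (N + 1)) := fun h =>
    (hφ (Nat.lt_succ_self N)).ne (g.injective (Subtype.ext h))
  -- orthogonal vectors of length at least `ε` are at least `ε` apart
  have h2 : ‖T (v (g (φ N))) - T (v (g (φ (N + 1))))‖ ^ 2 =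
      ‖μ (g (φ N))‖ ^ 2 + ‖μ (g (φ (N + 1)))‖ ^ 2 := by
    have h0 : ⟪T (v (g (φ N))), T (v (g (φ (N + 1))))⟫_ℂ = 0 := by
      rw [hμ, hμ, inner_smul_left, inner_smul_right, hv.2 hne, mul_zero, mul_zero]
    rw [norm_sub_sq (𝕜 := ℂ), h0, hμ, hμ, norm_smul, norm_smul, hv.1, hv.1]
    simp
  simp only [Function.comp_apply, dist_eq_norm] at h1
  have h3 : ε ≤ ‖μ (g (φ N))‖ := (g (φ N)).2
  nlinarith [norm_nonneg (T (v (g (φ N))) - T (v (g (φ (N + 1))))),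
    sq_nonneg ‖μ (g (φ (N + 1)))‖]

/-- The spectral theorem for a compact positive injective operator on an infinite-dimensional Hilbert
space: there is a Hilbert basis of eigenvectors whose inverse eigenvalues increase to infinity. -/
theorem IsCompactOperator.exists_hilbertBasis [CompleteSpace H] (hH : ¬ FiniteDimensional ℂ H)
    {T : H →L[ℂ] H} (hT : IsCompactOperator T) (hsymm : (T : H →ₗ[ℂ] H).IsSymmetric)
    (hpos : ∀ x, x ≠ 0 → 0 < (⟪x, T x⟫_ℂ).re) :
    ∃ (e : HilbertBasis ℕ ℂ H) (ν : ℕ → ℝ), Monotone ν ∧ Tendsto ν atTop atTop ∧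
      (∀ k, 0 < ν k) ∧ ∀ k, T (e k) = (((ν k)⁻¹ : ℝ) : ℂ) • e k := by
  classical
  let E : ℂ → Submodule ℂ H := fun μ => Module.End.eigenspace (T : H →ₗ[ℂ] H) μ
  have hE0 : E 0 = ⊥ := by
    rw [eq_bot_iff]
    intro x hx
    by_contra hx0
    have h1 : T x = 0 := by simpa [E] using hx
    have := hpos x hx0
    simp [h1] at this
  have hfd (μ : ℂ) : FiniteDimensional ℂ (E μ) := by
    by_cases h : μ = 0
    · rw [h, hE0]
      infer_instance
    · exact ContinuousLinearMap.finite_dimensional_eigenspace hT μ h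
  let b : ∀ μ : ℂ, OrthonormalBasis (Fin (Module.finrank ℂ (E μ))) ℂ (E μ) := fun μ =>
    stdOrthonormalBasis ℂ (E μ)
  let ι := Σ μ : ℂ, Fin (Module.finrank ℂ (E μ))
  let v : ι → H := fun a => (b a.1 a.2 : H)
  have hv : Orthonormal ℂ v :=
    hsymm.orthogonalFamily_eigenspaces.orthonormal_sigma_orthonormal
      (v_family := fun μ => b μ) fun μ => (b μ).orthonormal
  have hTv (a : ι) : T (v a) = a.1 • v a := Module.End.mem_eigenspace_iff.1 (b a.1 a.2).2
  have hre (a : ι) : 0 < a.1.re := by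
    have h1 := hpos (v a) (hv.ne_zero a)
    rw [hTv, inner_smul_right, inner_self_eq_norm_sq_to_K, hv.1 a] at h1
    simpa using h1
  have him (a : ι) : a.1.im = 0 := by
    have h1 := hsymm (v a) (v a)
    simp only [ContinuousLinearMap.coe_coe] at h1
    rw [hTv, inner_smul_left, inner_smul_right] at h1
    exact Complex.conj_eq_iff_im.1 (mul_right_cancel₀ (inner_self_ne_zero.2 (hv.ne_zero a)) h1)
  have hval (a : ι) : a.1 = ((a.1.re : ℝ) : ℂ) := Complex.ext rfl (by simp [him])
  have hspan : (Submodule.span ℂ (Set.range v))ᗮ = ⊥ := by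
    rw [eq_bot_iff, ← ContinuousLinearMap.orthogonalComplement_iSup_eigenspaces_eq_bot hT hsymm]
    refine Submodule.orthogonal_le (iSup_le fun μ x hx => ?_)
    have h1 := (b μ).sum_repr ⟨x, hx⟩
    have h2 : x = ∑ k, (b μ).repr ⟨x, hx⟩ k • v ⟨μ, k⟩ := by
      have := congrArg (Subtype.val) h1
      simpa [v] using this.symm
    rw [h2]
    exact Submodule.sum_mem _ fun k _ =>
      Submodule.smul_mem _ _ (Submodule.subset_span ⟨⟨μ, k⟩, rfl⟩)
  have hfin (C : ℝ) : {a : ι | a.1.re⁻¹ ≤ C}.Finite := by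
    refine (hT.finite_setOf_le_eigenvalue hv hTv (ε := (max C 1)⁻¹) (by positivity)).subset ?_
    intro a ha
    have h1 : (a.1.re)⁻¹ ≤ max C 1 := le_max_of_le_left ha
    refine (inv_le_of_inv_le₀ (hre a) h1).trans ?_
    exact (le_abs_self _).trans (Complex.abs_re_le_norm _)
  have hinf : Infinite ι := by
    by_contra h
    rw [not_infinite_iff_finite] at h
    have : Fintype ι := Fintype.ofFinite ι
    exact hH ((HilbertBasis.mkOfOrthogonalEqBot hv hspan).toOrthonormalBasis.toBasis
      |>.finiteDimensional_of_finite)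
  obtain ⟨e, he⟩ := exists_equiv_nat_monotone (fun a : ι => a.1.re⁻¹) hfin
  have hve : Orthonormal ℂ (v ∘ e) := hv.comp e e.injective
  have hspane : (Submodule.span ℂ (Set.range (v ∘ e)))ᗮ = ⊥ := by
    rw [e.surjective.range_comp, hspan]
  refine ⟨HilbertBasis.mkOfOrthogonalEqBot hve hspane, fun k => (e k).1.re⁻¹, he, ?_,
    fun k => inv_pos.2 (hre _), fun k => ?_⟩
  · rw [tendsto_atTop]
    intro C
    have h1 : {k : ℕ | (e k).1.re⁻¹ ≤ C}.Finite :=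
      (hfin C).preimage e.injective.injOn
    obtain ⟨N, hN⟩ := h1.bddAbove
    filter_upwards [eventually_gt_atTop N] with k hk
    by_contra! h
    exact absurd (hN (show k ∈ {k : ℕ | (e k).1.re⁻¹ ≤ C} from h.le)) (not_le.2 hk)
  · rw [HilbertBasis.coe_mkOfOrthogonalEqBot, inv_inv, ← hval]
    exact hTv _

end CompactOperator

/-! ### Form operators and their eigenvalue sequences -/

theorem inner_self_eq_ofReal_norm_sq {E : Type*} [NormedAddCommGroup E] [InnerProductSpace ℂ E]
    (x : E) : ⟪x, x⟫_ℂ = ((‖x‖ ^ 2 : ℝ) : ℂ) := by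
  rw [inner_self_eq_norm_sq_to_K]
  push_cast
  rfl

theorem horizontalForm_eq_inner {n : ℕ} {Ω : Set (Heis n)} (p q : FirstOrderPair Ω) :
    horizontalForm p q = ⟪p.snd, q.snd⟫_ℂ := by
  rw [PiLp.inner_apply]
  rfl

theorem eq_zero_of_forall_inner_testFunctions {n : ℕ} {Ω : Set (Heis n)} (hΩ : IsOpen Ω)
    {f : L2 Ω} (h : ∀ q ∈ S1.testFunctions Ω, ⟪q.fst, f⟫_ℂ = 0) : f = 0 := by
  refine L2.eq_zero_of_forall_integral_mul hΩ f fun φ hφ => ?_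
  have := h _ (smoothPair_mem_testFunctions hφ.conj)
  rw [L2.inner_eq_integral (smoothPair_fst_ae _ _) (EventuallyEq.refl _ _)] at this
  simpa [mul_comm] using this

/-- Eigenvectors of the operator of a form, in terms of the form. -/
theorem formOperator_apply_eq_smul_iff {n : ℕ} {Ω : Set (Heis n)} (hΩ : IsOpen Ω)
    {Q : Submodule ℂ (FirstOrderPair Ω)} (hQ : S1.testFunctions Ω ≤ Q) (hQ' : Q ≤ S1 Ω)
    (e : L2 Ω) (c : ℂ) :
    (∃ he : e ∈ (formOperator Q).domain, formOperator Q ⟨e, he⟩ = c • e) ↔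
      ∃ p ∈ Q, p.fst = e ∧ ∀ q ∈ Q, ⟪q.snd, p.snd⟫_ℂ = c * ⟪q.fst, e⟫_ℂ := by
  have hg : ∀ x ∈ formGraph Q, x.1 = 0 → x.2 = 0 := by
    rintro ⟨u, f⟩ ⟨p, hp, rfl, hpq⟩ h0
    have hp0 : p = 0 := eq_zero_of_mem_S1 hΩ (hQ' hp) h0
    refine eq_zero_of_forall_inner_testFunctions hΩ fun q hq => ?_
    rw [← hpq q (hQ hq), hp0, horizontalForm_eq_inner]
    simp
  have hgraph : (e, c • e) ∈ formGraph Q ↔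
      ∃ p ∈ Q, p.fst = e ∧ ∀ q ∈ Q, ⟪q.snd, p.snd⟫_ℂ = c * ⟪q.fst, e⟫_ℂ := by
    simp only [← horizontalForm_eq_inner, ← inner_smul_right]
    rfl
  rw [← hgraph, ← Submodule.toLinearPMap_graph_eq _ hg, LinearPMap.mem_graph_iff]
  constructor
  · rintro ⟨he, h⟩
    exact ⟨⟨e, he⟩, rfl, h⟩
  · rintro ⟨⟨x, hx⟩, rfl, h⟩
    exact ⟨hx, h⟩

/-- If `J : V → H` is a compact embedding of Hilbert spaces with dense range, the eigenvectors of
`J J†` form a Hilbert basis of `H` and lift to eigenvectors of the inner product of `V` relative to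
that of `H`. -/
theorem exists_hilbertBasis_of_isCompactOperator {V H : Type*} [NormedAddCommGroup V]
    [InnerProductSpace ℂ V] [CompleteSpace V] [NormedAddCommGroup H] [InnerProductSpace ℂ H]
    [CompleteSpace H] (hH : ¬ FiniteDimensional ℂ H) (J : V →L[ℂ] H) (hJ : IsCompactOperator J)
    (hdense : ∀ x : H, (∀ v, ⟪J v, x⟫_ℂ = 0) → x = 0) :
    ∃ (e : HilbertBasis ℕ ℂ H) (ν : ℕ → ℝ) (p : ℕ → V), Monotone ν ∧ Tendsto ν atTop atTop ∧
      ∀ k, J (p k) = e k ∧ ∀ v, ⟪v, p k⟫_ℂ = (ν k : ℂ) * ⟪J v, e k⟫_ℂ := by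
  let A : H →L[ℂ] V := ContinuousLinearMap.adjoint J
  let T : H →L[ℂ] H := J.comp A
  have hT : IsCompactOperator T := hJ.comp_clm A
  have hTinner (x y : H) : ⟪x, T y⟫_ℂ = ⟪A x, A y⟫_ℂ :=
    (ContinuousLinearMap.adjoint_inner_left J _ x).symm
  have hsymm : (T : H →ₗ[ℂ] H).IsSymmetric := by
    intro x y
    simp only [ContinuousLinearMap.coe_coe]
    rw [hTinner, ← inner_conj_symm, hTinner, inner_conj_symm]
  have hpos (x : H) (hx : x ≠ 0) : 0 < (⟪x, T x⟫_ℂ).re := by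
    have h0 : A x ≠ 0 := by
      intro h
      refine hx (hdense x fun v => ?_)
      rw [← ContinuousLinearMap.adjoint_inner_right J v x]
      exact (congrArg _ h).trans (inner_zero_right v)
    rw [hTinner, inner_self_eq_ofReal_norm_sq, Complex.ofReal_re]
    have := norm_pos_iff.2 h0
    positivity
  obtain ⟨e, ν, hmono, htend, hν, he⟩ := hT.exists_hilbertBasis hH hsymm hpos
  refine ⟨e, ν, fun k => (ν k : ℂ) • A (e k), hmono, htend, fun k => ⟨?_, fun v => ?_⟩⟩
  · have hνk : (ν k : ℂ) ≠ 0 := by exact_mod_cast (hν k).ne'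
    have h1 : J (A (e k)) = T (e k) := rfl
    rw [map_smul, h1, he, smul_smul, Complex.ofReal_inv, mul_inv_cancel₀ hνk, one_smul]
  · rw [inner_smul_right]
    exact congrArg _ (ContinuousLinearMap.adjoint_inner_right J v (e k))

/-- The operator of a form with a closed form domain that embeds compactly into `L₂(Ω)` has purely
discrete spectrum. -/
theorem exists_isEigenvalueSequence {n : ℕ} {Ω : Set (Heis n)} (hΩ : IsOpen Ω)
    (hinf : ¬ FiniteDimensional ℂ (L2 Ω)) {Q : Submodule ℂ (FirstOrderPair Ω)}
    (hQ : S1.testFunctions Ω ≤ Q) (hQ' : Q ≤ S1 Ω)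
    (hQc : IsClosed (Q : Set (FirstOrderPair Ω)))
    (hcomp : IsCompactOperator fun p : Q => (p : FirstOrderPair Ω).fst) :
    ∃ lam : ℕ → ℝ, IsEigenvalueSequence (formOperator Q) lam := by
  have : CompleteSpace Q := hQc.completeSpace_coe
  let J : Q →L[ℂ] L2 Ω := (WithLp.fstL 2 ℂ _ _).comp Q.subtypeL
  obtain ⟨e, ν, p, hmono, htend, hp⟩ := exists_hilbertBasis_of_isCompactOperator
    (V := Q) (H := L2 Ω) hinf J hcomp fun x hx =>
      eq_zero_of_forall_inner_testFunctions hΩ fun q hq => hx ⟨q, hQ hq⟩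
  -- the inner product of `S¹(Ω)` is the form plus the inner product of `L₂(Ω)`
  refine ⟨fun k => ν k - 1, fun a b hab => sub_le_sub_right (hmono hab) 1,
    tendsto_atTop_add_const_right _ (-1) htend, e, fun k => ?_⟩
  refine (formOperator_apply_eq_smul_iff hΩ hQ hQ' (e k) _).2
    ⟨p k, (p k).2, (hp k).1, fun q hq => ?_⟩
  have hfst : (p k : FirstOrderPair Ω).fst = e k := (hp k).1
  have h1 : ⟪(⟨q, hq⟩ : Q), p k⟫_ℂ = (ν k : ℂ) * ⟪q.fst, e k⟫_ℂ := (hp k).2 ⟨q, hq⟩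
  have h2 : ⟪(⟨q, hq⟩ : Q), p k⟫_ℂ =
      ⟪q.fst, (p k : FirstOrderPair Ω).fst⟫_ℂ + ⟪q.snd, (p k : FirstOrderPair Ω).snd⟫_ℂ :=
    WithLp.prod_inner_apply _ _
  rw [h1, hfst] at h2
  push_cast
  linear_combination -h2

/-- The data of an eigenvalue sequence in terms of the form. -/
theorem IsEigenvalueSequence.exists_form_eigenvectors {n : ℕ} {Ω : Set (Heis n)} (hΩ : IsOpen Ω)
    {Q : Submodule ℂ (FirstOrderPair Ω)} (hQ : S1.testFunctions Ω ≤ Q) (hQ' : Q ≤ S1 Ω)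
    {lam : ℕ → ℝ} (h : IsEigenvalueSequence (formOperator Q) lam) :
    ∃ (e : HilbertBasis ℕ ℂ (L2 Ω)) (p : ℕ → FirstOrderPair Ω), ∀ k, p k ∈ Q ∧
      (p k).fst = e k ∧ ∀ q ∈ Q, ⟪q.snd, (p k).snd⟫_ℂ = (lam k : ℂ) * ⟪q.fst, e k⟫_ℂ := by
  obtain ⟨-, -, e, he⟩ := h
  choose p hp using fun k =>
    (formOperator_apply_eq_smul_iff hΩ hQ hQ' (e k) (lam k)).1 (he k)
  exact ⟨e, p, hp⟩

/-! ### Variational estimates -/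

section Variational

variable {n : ℕ} {Ω : Set (Heis n)}

theorem eigenvalue_pos_of_mem_S1zero (hn : 1 ≤ n) (hΩ : IsOpen Ω) {p : FirstOrderPair Ω}
    (hp : p ∈ S1zero Ω) (hp0 : p.fst ≠ 0) {l : ℝ}
    (h : ⟪p.snd, p.snd⟫_ℂ = (l : ℂ) * ⟪p.fst, p.fst⟫_ℂ) : 0 < l := by
  have h1 : p.snd ≠ 0 := fun h0 =>
    hp0 (eq_zero_of_snd_eq_zero hΩ ⟨0, hn⟩ hp (by rw [h0]; rfl))
  rw [inner_self_eq_ofReal_norm_sq, inner_self_eq_ofReal_norm_sq] at h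
  have h2 : ‖p.snd‖ ^ 2 = l * ‖p.fst‖ ^ 2 := by exact_mod_cast h
  have h3 : 0 < ‖p.snd‖ ^ 2 := by
    have := norm_pos_iff.2 h1
    positivity
  rw [h2] at h3
  exact pos_of_mul_pos_left h3 (by positivity)

/-- Bessel's inequality for the form, relative to its eigenvectors. -/
theorem sum_eigenvalue_mul_norm_inner_sq_le {Q : Submodule ℂ (FirstOrderPair Ω)} {e : ℕ → L2 Ω}
    (he : Orthonormal ℂ e) {p : ℕ → FirstOrderPair Ω} {lam : ℕ → ℝ}
    (h : ∀ k, p k ∈ Q ∧ (p k).fst = e k ∧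
      ∀ q ∈ Q, ⟪q.snd, (p k).snd⟫_ℂ = (lam k : ℂ) * ⟪q.fst, e k⟫_ℂ)
    {w : FirstOrderPair Ω} (hw : w ∈ Q) (s : Finset ℕ) :
    ∑ k ∈ s, lam k * ‖⟪e k, w.fst⟫_ℂ‖ ^ 2 ≤ ‖w.snd‖ ^ 2 := by
  let y : FirstOrderPair Ω := ∑ k ∈ s, ⟪e k, w.fst⟫_ℂ • p k
  have hy : y ∈ Q := Q.sum_mem fun k _ => Q.smul_mem _ (h k).1
  have hy1 : y.fst = ∑ k ∈ s, ⟪e k, w.fst⟫_ℂ • e k := by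
    have : y.fst = ∑ k ∈ s, ⟪e k, w.fst⟫_ℂ • (p k).fst := by
      exact map_sum (WithLp.fstₗ 2 ℂ (L2 Ω) (PiLp 2 fun _ : Fin n ⊕ Fin n => L2 Ω))
        (fun k => ⟪e k, w.fst⟫_ℂ • p k) s
    rw [this]
    exact Finset.sum_congr rfl fun k _ => by rw [(h k).2.1]
  have hy2 : y.snd = ∑ k ∈ s, ⟪e k, w.fst⟫_ℂ • (p k).snd := by
    exact map_sum (WithLp.sndₗ 2 ℂ (L2 Ω) (PiLp 2 fun _ : Fin n ⊕ Fin n => L2 Ω))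
        (fun k => ⟪e k, w.fst⟫_ℂ • p k) s
  have hform (q : FirstOrderPair Ω) (hq : q ∈ Q) : ⟪q.snd, y.snd⟫_ℂ =
      ∑ k ∈ s, ⟪e k, w.fst⟫_ℂ * (lam k * ⟪q.fst, e k⟫_ℂ) := by
    rw [hy2, inner_sum]
    exact Finset.sum_congr rfl fun k _ => by rw [inner_smul_right, (h k).2.2 q hq]
  have hsum : ((∑ k ∈ s, lam k * ‖⟪e k, w.fst⟫_ℂ‖ ^ 2 : ℝ) : ℂ) =
      ∑ k ∈ s, ⟪e k, w.fst⟫_ℂ * (lam k * (starRingEnd ℂ) ⟪e k, w.fst⟫_ℂ) := by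
    push_cast
    refine Finset.sum_congr rfl fun k _ => ?_
    rw [← Complex.mul_conj']
    ring
  have h1 : ⟪w.snd, y.snd⟫_ℂ = ((∑ k ∈ s, lam k * ‖⟪e k, w.fst⟫_ℂ‖ ^ 2 : ℝ) : ℂ) := by
    rw [hform w hw, hsum]
    exact Finset.sum_congr rfl fun k _ => by rw [inner_conj_symm]
  have h2 : ⟪y.snd, y.snd⟫_ℂ = ((∑ k ∈ s, lam k * ‖⟪e k, w.fst⟫_ℂ‖ ^ 2 : ℝ) : ℂ) := by
    rw [hform y hy, hsum]
    refine Finset.sum_congr rfl fun k hk => ?_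
    rw [hy1, he.inner_left_sum _ hk]
  have h3 : 0 ≤ ‖w.snd - y.snd‖ ^ 2 := by positivity
  rw [norm_sub_sq (𝕜 := ℂ), h1] at h3
  have h4 : ‖y.snd‖ ^ 2 = ∑ k ∈ s, lam k * ‖⟪e k, w.fst⟫_ℂ‖ ^ 2 := by
    rw [inner_self_eq_ofReal_norm_sq] at h2
    exact_mod_cast h2
  rw [h4, RCLike.re_eq_complex_re, Complex.ofReal_re] at h3
  linarith

/-- On the orthogonal complement of the eigenvectors with eigenvalue at most `l`, the form is strictly
above `l`. -/
theorem mul_norm_sq_lt_of_orthogonal {Q : Submodule ℂ (FirstOrderPair Ω)}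
    {e : HilbertBasis ℕ ℂ (L2 Ω)} {p : ℕ → FirstOrderPair Ω} {lam : ℕ → ℝ}
    (h : ∀ k, p k ∈ Q ∧ (p k).fst = e k ∧
      ∀ q ∈ Q, ⟪q.snd, (p k).snd⟫_ℂ = (lam k : ℂ) * ⟪q.fst, e k⟫_ℂ)
    {w : FirstOrderPair Ω} (hw : w ∈ Q) (hw0 : w.fst ≠ 0) {l : ℝ}
    (horth : ∀ k, lam k ≤ l → ⟪e k, w.fst⟫_ℂ = 0) : l * ‖w.fst‖ ^ 2 < ‖w.snd‖ ^ 2 := by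
  have hsum : HasSum (fun k => ‖⟪e k, w.fst⟫_ℂ‖ ^ 2) (‖w.fst‖ ^ 2) := by
    have h1 := e.hasSum_inner_mul_inner w.fst w.fst
    have h2 : (fun k => ⟪w.fst, e k⟫_ℂ * ⟪e k, w.fst⟫_ℂ) =
        fun k => ((‖⟪e k, w.fst⟫_ℂ‖ ^ 2 : ℝ) : ℂ) := by
      funext k
      rw [← inner_conj_symm w.fst (e k), Complex.conj_mul']
      push_cast
      rfl
    rw [h2, inner_self_eq_ofReal_norm_sq] at h1
    exact_mod_cast h1
  obtain ⟨k₀, hk₀⟩ : ∃ k, ⟪e k, w.fst⟫_ℂ ≠ 0 := by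
    by_contra! hall
    simp only [hall, norm_zero, ne_eq, OfNat.ofNat_ne_zero, not_false_eq_true, zero_pow] at hsum
    have := hsum.unique hasSum_zero
    exact hw0 (by simpa using this)
  have hk₀l : l < lam k₀ := not_le.1 fun hle => hk₀ (horth k₀ hle)
  have hterm (k : ℕ) : l * ‖⟪e k, w.fst⟫_ℂ‖ ^ 2 ≤ lam k * ‖⟪e k, w.fst⟫_ℂ‖ ^ 2 := by
    by_cases hk : lam k ≤ l
    · simp [horth k hk]
    · gcongr
      exact (not_le.1 hk).le
  have hδ : 0 < (lam k₀ - l) * ‖⟪e k₀, w.fst⟫_ℂ‖ ^ 2 := by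
    have := norm_pos_iff.2 hk₀
    have := sub_pos.2 hk₀l
    positivity
  have hle : (lam k₀ - l) * ‖⟪e k₀, w.fst⟫_ℂ‖ ^ 2 + l * ‖w.fst‖ ^ 2 ≤ ‖w.snd‖ ^ 2 := by
    have hlim : Tendsto (fun s : Finset ℕ => (lam k₀ - l) * ‖⟪e k₀, w.fst⟫_ℂ‖ ^ 2 +
        ∑ k ∈ s, l * ‖⟪e k, w.fst⟫_ℂ‖ ^ 2) atTop
        (𝓝 ((lam k₀ - l) * ‖⟪e k₀, w.fst⟫_ℂ‖ ^ 2 + l * ‖w.fst‖ ^ 2)) :=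
      tendsto_const_nhds.add (hsum.mul_left l)
    refine le_of_tendsto hlim ?_
    filter_upwards [eventually_ge_atTop {k₀}] with s hs
    refine le_trans ?_ (sum_eigenvalue_mul_norm_inner_sq_le e.orthonormal h hw s)
    have hk₀s : k₀ ∈ s := hs (Finset.mem_singleton_self k₀)
    rw [← Finset.add_sum_erase _ _ hk₀s, ← Finset.add_sum_erase s (fun k => lam k * _) hk₀s]
    have := Finset.sum_le_sum fun k (_ : k ∈ s.erase k₀) => hterm k
    linarith
  linarith

end Variational

/-! ### Comparison of Dirichlet and Neumann eigenvalues -/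

theorem exists_notMem_of_linearIndependent {E : Type*} [AddCommGroup E] [Module ℂ E]
    {u : ℕ → E} (hu : LinearIndependent ℂ u) (W : Submodule ℂ E) [FiniteDimensional ℂ W] :
    ∃ m, u m ∉ W := by
  by_contra! h
  have h1 : LinearIndependent ℂ fun m => (⟨u m, h m⟩ : W) :=
    LinearIndependent.of_comp W.subtype hu
  exact Module.Finite.not_linearIndependent_of_infinite _ h1

theorem not_finiteDimensional_L2 {n : ℕ} (hn : 1 ≤ n) {Ω : Set (Heis n)} (hΩ : IsOpen Ω)
    (hne : Ω.Nonempty) (hfin : volume Ω < ⊤) : ¬ FiniteDimensional ℂ (L2 Ω) := by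
  intro h
  obtain ⟨ξ, -, hξ⟩ := exists_frequencies (⟨0, hn⟩ : Fin n) one_pos
  exact Module.Finite.not_linearIndependent_of_infinite _
    (linearIndependent_characterPair hΩ hne hfin ξ _ hξ)

section Comparison

variable {n : ℕ} {Ω : Set (Heis n)}

theorem fst_linearCombination {ι : Type*} [Fintype ι] (p : ι → FirstOrderPair Ω) (c : ι → ℂ) :
    (Fintype.linearCombination ℂ p c).fst = ∑ k, c k • (p k).fst :=
  map_sum (WithLp.fstₗ 2 ℂ (L2 Ω) (PiLp 2 fun _ : Fin n ⊕ Fin n => L2 Ω))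
    (fun k => c k • p k) Finset.univ

theorem snd_linearCombination {ι : Type*} [Fintype ι] (p : ι → FirstOrderPair Ω) (c : ι → ℂ) :
    (Fintype.linearCombination ℂ p c).snd = ∑ k, c k • (p k).snd :=
  map_sum (WithLp.sndₗ 2 ℂ (L2 Ω) (PiLp 2 fun _ : Fin n ⊕ Fin n => L2 Ω))
    (fun k => c k • p k) Finset.univ

theorem inner_snd_linearCombination {ι : Type*} [Fintype ι] {p : ι → FirstOrderPair Ω}
    {e : ι → L2 Ω} {l : ι → ℝ} {q : FirstOrderPair Ω}
    (h : ∀ k, ⟪q.snd, (p k).snd⟫_ℂ = (l k : ℂ) * ⟪q.fst, e k⟫_ℂ) (c : ι → ℂ) :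
    ⟪q.snd, (Fintype.linearCombination ℂ p c).snd⟫_ℂ =
      ∑ k, c k * (l k * ⟪q.fst, e k⟫_ℂ) := by
  rw [snd_linearCombination, inner_sum]
  exact Finset.sum_congr rfl fun k _ => by rw [inner_smul_right, h]

/-- On the span of eigenvectors with eigenvalues at most `l`, the form is at most `l`. -/
theorem norm_snd_linearCombination_le {ι : Type*} [Fintype ι] {Q : Submodule ℂ (FirstOrderPair Ω)}
    {p : ι → FirstOrderPair Ω} {e : ι → L2 Ω} (he : Orthonormal ℂ e) {lam : ι → ℝ}
    (h : ∀ k, p k ∈ Q ∧ (p k).fst = e k ∧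
      ∀ q ∈ Q, ⟪q.snd, (p k).snd⟫_ℂ = (lam k : ℂ) * ⟪q.fst, e k⟫_ℂ) {l : ℝ}
    (hl : ∀ k, lam k ≤ l) (c : ι → ℂ) :
    ‖(Fintype.linearCombination ℂ p c).snd‖ ^ 2 ≤
      l * ‖(Fintype.linearCombination ℂ p c).fst‖ ^ 2 := by
  have hfst : (Fintype.linearCombination ℂ p c).fst = ∑ k, c k • e k := by
    rw [fst_linearCombination]
    exact Finset.sum_congr rfl fun k _ => by rw [(h k).2.1]
  have hmem : Fintype.linearCombination ℂ p c ∈ Q :=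
    Q.sum_mem fun k _ => Q.smul_mem _ (h k).1
  have h1 := inner_snd_linearCombination (fun k => (h k).2.2 _ hmem) c
  have h2 : ⟪(Fintype.linearCombination ℂ p c).fst, (Fintype.linearCombination ℂ p c).fst⟫_ℂ =
      ((∑ k, ‖c k‖ ^ 2 : ℝ) : ℂ) := by
    rw [hfst, he.inner_sum]
    push_cast
    exact Finset.sum_congr rfl fun k _ => Complex.conj_mul' _
  have h3 : ⟪(Fintype.linearCombination ℂ p c).snd, (Fintype.linearCombination ℂ p c).snd⟫_ℂ =
      ((∑ k, lam k * ‖c k‖ ^ 2 : ℝ) : ℂ) := by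
    rw [h1]
    push_cast
    refine Finset.sum_congr rfl fun k _ => ?_
    rw [hfst, he.inner_left_fintype, ← Complex.mul_conj']
    ring
  rw [inner_self_eq_ofReal_norm_sq] at h2 h3
  rw [Complex.ofReal_injective h2, Complex.ofReal_injective h3, Finset.mul_sum]
  exact Finset.sum_le_sum fun k _ => by gcongr; exact hl k

/-- Adding to a function `v` of `S̊¹(Ω)` a Neumann eigenfunction `y` and a multiple of a generalized
eigenfunction `u` with the right energy does not change the form shifted by `l`. -/
theorem norm_snd_sq_le_of_add {l : ℝ} {v y u : FirstOrderPair Ω} (c : ℂ)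
    (hv : v ∈ S1 Ω) (hy : y ∈ S1 Ω) (hu : u ∈ S1 Ω)
    (hvv : ‖v.snd‖ ^ 2 ≤ l * ‖v.fst‖ ^ 2)
    (hqy : ∀ q ∈ S1 Ω, ⟪q.snd, y.snd⟫_ℂ = (l : ℂ) * ⟪q.fst, y.fst⟫_ℂ)
    (hvu : ⟪v.snd, u.snd⟫_ℂ = (l : ℂ) * ⟪v.fst, u.fst⟫_ℂ)
    (huu : ⟪u.snd, u.snd⟫_ℂ = (l : ℂ) * ⟪u.fst, u.fst⟫_ℂ) :
    ‖(v + y + c • u).snd‖ ^ 2 ≤ l * ‖(v + y + c • u).fst‖ ^ 2 := by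
  have symm {p q : FirstOrderPair Ω} (h : ⟪p.snd, q.snd⟫_ℂ = (l : ℂ) * ⟪p.fst, q.fst⟫_ℂ) :
      ⟪q.snd, p.snd⟫_ℂ = (l : ℂ) * ⟪q.fst, p.fst⟫_ℂ := by
    rw [← inner_conj_symm q.snd, ← inner_conj_symm q.fst, h, map_mul, Complex.conj_ofReal]
  have key : ⟪(v + y + c • u).snd, (v + y + c • u).snd⟫_ℂ -
      (l : ℂ) * ⟪(v + y + c • u).fst, (v + y + c • u).fst⟫_ℂ =
      ⟪v.snd, v.snd⟫_ℂ - (l : ℂ) * ⟪v.fst, v.fst⟫_ℂ := by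
    simp only [WithLp.add_snd, WithLp.add_fst, WithLp.smul_snd, WithLp.smul_fst, inner_add_left,
      inner_add_right, inner_smul_left, inner_smul_right, hqy v hv, hqy y hy, hqy u hu,
      symm (hqy v hv), symm (hqy u hu), hvu, symm hvu, huu]
    ring
  simp only [inner_self_eq_ofReal_norm_sq] at key
  have key' : ‖(v + y + c • u).snd‖ ^ 2 - l * ‖(v + y + c • u).fst‖ ^ 2 =
      ‖v.snd‖ ^ 2 - l * ‖v.fst‖ ^ 2 := by exact_mod_cast key
  linarith

/-- Strict comparison of Neumann and Dirichlet eigenvalues. -/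
theorem neumann_lt_dirichlet (hn : 1 ≤ n) (hΩ : IsOpen Ω) (hne : Ω.Nonempty)
    (hfin : volume Ω < ⊤) {lamN lamD : ℕ → ℝ}
    (hN : IsEigenvalueSequence (neumannSubLaplacian Ω) lamN)
    (hD : IsEigenvalueSequence (dirichletSubLaplacian Ω) lamD) (j : ℕ) :
    lamN (j + 1) < lamD j := by
  classical
  have hle0 := Submodule.le_topologicalClosure (S1.testFunctions Ω)
  obtain ⟨eN, pN, hpN⟩ :=
    IsEigenvalueSequence.exists_form_eigenvectors hΩ (testFunctions_le_S1 Ω) le_rfl hN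
  obtain ⟨eD, pD, hpD⟩ :=
    IsEigenvalueSequence.exists_form_eigenvectors (Q := S1zero Ω) hΩ hle0 (S1zero_le_S1 Ω) hD
  obtain ⟨hNmono, hNtend, -⟩ := hN
  obtain ⟨hDmono, -, -⟩ := hD
  set l := lamD j with hl
  have hlpos : 0 < l := by
    refine eigenvalue_pos_of_mem_S1zero hn hΩ (hpD j).1 ?_ ?_ (p := pD j)
    · rw [(hpD j).2.1]
      exact eD.orthonormal.ne_zero j
    · rw [(hpD j).2.2 _ (hpD j).1, (hpD j).2.1]
  by_contra! hcon
  -- `M` indexes the Neumann eigenvalues up to `l`, and `K` those equal to `l`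
  have hMfin : {k | lamN k ≤ l}.Finite := by
    obtain ⟨N, hN'⟩ := (hNtend.eventually_gt_atTop l).exists_forall_of_atTop
    refine (Set.finite_lt_nat N).subset fun k hk => ?_
    by_contra hkN
    exact absurd hk (not_le.2 (hN' k (not_lt.1 hkN)))
  let M : Finset ℕ := hMfin.toFinset
  let K : Finset ℕ := M.filter fun k => lamN k = l
  have hcard : M.card ≤ (j + 1) + K.card := by
    have h1 : M ⊆ Finset.range (j + 1) ∪ K := by
      intro k hk
      have hk' : lamN k ≤ l := by simpa [M] using hk
      by_cases hkl : lamN k = l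
      · exact Finset.mem_union_right _ (Finset.mem_filter.2 ⟨hk, hkl⟩)
      · refine Finset.mem_union_left _ (Finset.mem_range.2 ?_)
        by_contra hkj
        exact absurd (hcon.trans (hNmono (not_lt.1 hkj))) (not_le.2 (lt_of_le_of_ne hk' hkl))
    calc M.card ≤ (Finset.range (j + 1) ∪ K).card := Finset.card_le_card h1
      _ ≤ _ := (Finset.card_union_le _ _).trans (by simp)
  let pD' : Fin (j + 1) → FirstOrderPair Ω := fun k => pD k
  let pN' : K → FirstOrderPair Ω := fun k => pN k
  have hpD' (k : Fin (j + 1)) : pD' k ∈ S1zero Ω ∧ (pD' k).fst = eD k ∧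
      ∀ q ∈ S1zero Ω, ⟪q.snd, (pD' k).snd⟫_ℂ = (lamD k : ℂ) * ⟪q.fst, eD k⟫_ℂ := hpD k
  have hpN' (k : K) : pN' k ∈ S1 Ω ∧ (pN' k).fst = eN k ∧
      ∀ q ∈ S1 Ω, ⟪q.snd, (pN' k).snd⟫_ℂ = (l : ℂ) * ⟪q.fst, eN k⟫_ℂ := by
    have hk : lamN k = l := (Finset.mem_filter.1 k.2).2
    rw [← hk]
    exact hpN k
  have heD : Orthonormal ℂ fun k : Fin (j + 1) => eD k :=
    eD.orthonormal.comp _ Fin.val_injective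
  have heN : Orthonormal ℂ fun k : K => eN k := eN.orthonormal.comp _ Subtype.val_injective
  -- a character of energy `l` outside the span of the eigenfunctions in play
  obtain ⟨ξ, hξl, hξ⟩ := exists_frequencies (⟨0, hn⟩ : Fin n) hlpos
  have hfdD : FiniteDimensional ℂ (Submodule.span ℂ (Set.range fun k : Fin (j + 1) => eD k)) :=
    FiniteDimensional.span_of_finite ℂ (Set.finite_range _)
  have hfdN : FiniteDimensional ℂ (Submodule.span ℂ (Set.range fun k : K => eN k)) :=
    FiniteDimensional.span_of_finite ℂ (Set.finite_range _)
  obtain ⟨m, hm⟩ := exists_notMem_of_linearIndependent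
    (linearIndependent_characterPair hΩ hne hfin ξ _ hξ)
    (Submodule.span ℂ (Set.range fun k : Fin (j + 1) => eD k) ⊔
      Submodule.span ℂ (Set.range fun k : K => eN k))
  let u : FirstOrderPair Ω := characterPair hfin (ξ m)
  have hu : u ∈ S1 Ω := characterPair_mem_S1 hfin (ξ m)
  have hvu (v : FirstOrderPair Ω) (hv : v ∈ S1zero Ω) :
      ⟪v.snd, u.snd⟫_ℂ = (l : ℂ) * ⟪v.fst, u.fst⟫_ℂ := by
    rw [← horizontalForm_eq_inner, horizontalForm_characterPair hΩ hfin (ξ m) hv, hξl]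
  have huu : ⟪u.snd, u.snd⟫_ℂ = (l : ℂ) * ⟪u.fst, u.fst⟫_ℂ := by
    rw [← horizontalForm_eq_inner, horizontalForm_characterPair_self hfin (ξ m), hξl]
  let V := Fintype.linearCombination ℂ pD'
  let Y := Fintype.linearCombination ℂ pN'
  have hV (a : Fin (j + 1) → ℂ) : V a ∈ S1zero Ω := by
    rw [Fintype.linearCombination_apply]
    exact (S1zero Ω).sum_mem fun k _ => (S1zero Ω).smul_mem _ (hpD' k).1
  have hY (b : K → ℂ) : Y b ∈ S1 Ω := by
    rw [Fintype.linearCombination_apply]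
    exact (S1 Ω).sum_mem fun k _ => (S1 Ω).smul_mem _ (hpN' k).1
  have hVfst (a : Fin (j + 1) → ℂ) : (V a).fst = ∑ k, a k • eD k :=
    (fst_linearCombination pD' a).trans (Finset.sum_congr rfl fun k _ => by rw [(hpD' k).2.1])
  have hYfst (b : K → ℂ) : (Y b).fst = ∑ k, b k • eN k :=
    (fst_linearCombination pN' b).trans (Finset.sum_congr rfl fun k _ => by rw [(hpN' k).2.1])
  have hYform (b : K → ℂ) (q : FirstOrderPair Ω) (hq : q ∈ S1 Ω) :
      ⟪q.snd, (Y b).snd⟫_ℂ = (l : ℂ) * ⟪q.fst, (Y b).fst⟫_ℂ := by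
    have h1 := inner_snd_linearCombination (l := fun _ => l) (fun k => (hpN' k).2.2 q hq) b
    rw [hYfst, inner_sum, Finset.mul_sum]
    refine h1.trans (Finset.sum_congr rfl fun k _ => ?_)
    rw [inner_smul_right]
    ring
  -- a dimension count yields a trial function orthogonal to the eigenfunctions indexed by `M`
  let Φ : ((Fin (j + 1) → ℂ) × (K → ℂ)) × ℂ →ₗ[ℂ] FirstOrderPair Ω :=
    (V.coprod Y).coprod (LinearMap.toSpanSingleton ℂ _ u)
  have hΦ (x : ((Fin (j + 1) → ℂ) × (K → ℂ)) × ℂ) : Φ x = V x.1.1 + Y x.1.2 + x.2 • u := by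
    simp [Φ]
  let Ψ : ((Fin (j + 1) → ℂ) × (K → ℂ)) × ℂ →ₗ[ℂ] (M → ℂ) :=
    LinearMap.pi fun k => (innerSL ℂ (eN k) : L2 Ω →ₗ[ℂ] ℂ).comp
      ((WithLp.fstₗ 2 ℂ (L2 Ω) (PiLp 2 fun _ : Fin n ⊕ Fin n => L2 Ω)).comp Φ)
  have hker : LinearMap.ker Ψ ≠ ⊥ := by
    refine LinearMap.ker_ne_bot_of_finrank_lt ?_
    simp only [Module.finrank_prod, Module.finrank_fintype_fun_eq_card, Fintype.card_fin,
      Fintype.card_coe, Module.finrank_self]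
    omega
  obtain ⟨x, hx, hx0⟩ := Submodule.exists_mem_ne_zero_of_ne_bot hker
  have horth (k : ℕ) (hk : lamN k ≤ l) : ⟪eN k, (Φ x).fst⟫_ℂ = 0 :=
    congrFun (LinearMap.mem_ker.1 hx) ⟨k, by simpa [M] using hk⟩
  have hmem : Φ x ∈ S1 Ω := by
    rw [hΦ]
    exact (S1 Ω).add_mem ((S1 Ω).add_mem (S1zero_le_S1 Ω (hV _)) (hY _)) ((S1 Ω).smul_mem _ hu)
  have hle : ‖(Φ x).snd‖ ^ 2 ≤ l * ‖(Φ x).fst‖ ^ 2 := by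
    rw [hΦ]
    exact norm_snd_sq_le_of_add x.2 (S1zero_le_S1 Ω (hV _)) (hY _) hu
      (norm_snd_linearCombination_le heD hpD' (fun k => hDmono (Nat.lt_succ_iff.1 k.2)) _)
      (hYform _) (hvu _ (hV _)) huu
  by_cases hw0 : (Φ x).fst = 0
  swap
  · exact absurd (mul_norm_sq_lt_of_orthogonal hpN hmem hw0 horth) (not_lt.2 hle)
  -- the trial space has full dimension
  rw [hΦ] at hw0
  have hsum : (V x.1.1).fst + (Y x.1.2).fst + x.2 • u.fst = 0 := hw0
  have hc : x.2 = 0 := by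
    by_contra hc
    refine hm ?_
    have h1 : u.fst = (-x.2⁻¹) • ((V x.1.1).fst + (Y x.1.2).fst) := by
      rw [eq_neg_of_add_eq_zero_left hsum, smul_neg, neg_smul, neg_neg, smul_smul,
        inv_mul_cancel₀ hc, one_smul]
    change u.fst ∈ _
    rw [h1, hVfst, hYfst]
    refine Submodule.smul_mem _ _ (Submodule.add_mem_sup ?_ ?_)
    · exact Submodule.sum_mem _ fun k _ => Submodule.smul_mem _ _ (Submodule.subset_span ⟨k, rfl⟩)
    · exact Submodule.sum_mem _ fun k _ => Submodule.smul_mem _ _ (Submodule.subset_span ⟨k, rfl⟩)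
  rw [hc, zero_smul, add_zero] at hsum
  have hYV : Y x.1.2 = - V x.1.1 :=
    eq_of_mem_S1 hΩ (hY _) ((S1 Ω).neg_mem (S1zero_le_S1 Ω (hV _)))
      (eq_neg_of_add_eq_zero_right hsum)
  have hYzero : (Y x.1.2).fst = 0 := by
    refine eq_zero_of_mem_S1zero_of_neumann hΩ hfin hlpos.ne' ?_ fun q hq => ?_
    · rw [hYV]
      exact (S1zero Ω).neg_mem (hV _)
    · rw [horizontalForm_eq_inner]
      exact hYform _ q hq
  rw [hYzero, add_zero] at hsum
  rw [hYfst] at hYzero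
  rw [hVfst] at hsum
  have hb := Fintype.linearIndependent_iff.1 heN.linearIndependent _ hYzero
  have ha := Fintype.linearIndependent_iff.1 heD.linearIndependent _ hsum
  exact hx0 (Prod.ext (Prod.ext (funext ha) (funext hb)) hc)

end Comparison

theorem theorem3p4 (n : ℕ) (hn : 1 ≤ n) (Ω : Set (Heis n)) (hopen : IsOpen Ω)
    (hconn : IsConnected Ω) (hfin : volume Ω < ⊤)
    (hcompact : IsCompactOperator (S1.embedding Ω)) :
    (∃ lamN : ℕ → ℝ, IsEigenvalueSequence (neumannSubLaplacian Ω) lamN) ∧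
    (∃ lamD : ℕ → ℝ, IsEigenvalueSequence (dirichletSubLaplacian Ω) lamD) ∧
    ∀ lamN lamD : ℕ → ℝ,
      IsEigenvalueSequence (neumannSubLaplacian Ω) lamN →
      IsEigenvalueSequence (dirichletSubLaplacian Ω) lamD →
      ∀ j : ℕ, lamN (j + 1) < lamD j := by
  have hinf := not_finiteDimensional_L2 hn hopen hconn.nonempty hfin
  refine ⟨?_, ?_, fun lamN lamD hN hD j =>
    neumann_lt_dirichlet hn hopen hconn.nonempty hfin hN hD j⟩
  · exact exists_isEigenvalueSequence hopen hinf (testFunctions_le_S1 Ω) le_rfl (isClosed_S1 Ω)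
      hcompact
  · refine exists_isEigenvalueSequence (Q := S1zero Ω) hopen hinf
      (Submodule.le_topologicalClosure _) (S1zero_le_S1 Ω)
      (Submodule.isClosed_topologicalClosure _) ?_
    let ι : S1zero Ω →L[ℂ] S1 Ω := (S1zero Ω).subtypeL.codRestrict (S1 Ω) fun p =>
      S1zero_le_S1 Ω p.2
    exact hcompact.comp_clm ι
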